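/- Let $H$ be a separable Hilbert space and let $D$ be a densely defined closed symmetric operator in $H$ with deficiency indices $(1,1)$. Put $D_{\max}:=D^*$ and $\langle\xi,\eta\rangle_D:=\langle\xi,\eta\rangle+\langle D_{\max}\xi,D_{\max}\eta\rangle$ on $\operatorname{dom}(D_{\max})$. Let $\phi_\pm\in\operatorname{dom}(D_{\max})$ be vectors with $D_{\max}\phi_\pm=\pm i\,\phi_\pm$ and $\langle\phi_\pm,\phi_\pm\rangle_D=1$, and put $\alpha_\pm(\xi):=\langle\phi_\pm,\xi\rangle_D$ for $\xi\in\operatorname{dom}(D_{\max})$ (inner products are linear in the second variable). Let $X$ be a locally compact Hausdorff space, and let $E:=C_0(X,H)$ be the Hilbert $C^*$-module over $C_0(X)$ with inner product $\langle f,g\rangle(x)=\langle f(x),g(x)\rangle$. Let $\Lambda:X\to S^1$ be a Borel function, and let $T_\Lambda$ be the operator in $E$ with domain $$\operatorname{dom}(T_\Lambda)=\{f\in C_0(X,\operatorname{dom}(D_{\max})) : \alpha_+\circ f=\Lambda\cdot(\alpha_-\circ f)\},\qquad (T_\Lambda f)(x)=D_{\max}(f(x)),$$ where $\operatorname{dom}(D_{\max})$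 carries the graph norm $\|\xi\|_D=\langle\xi,\xi\rangle_D^{1/2}$. The adjoint $T^*$ of a densely defined operator $T$ in $E$ is defined by: $y\in\operatorname{dom}(T^*)$ and $T^*y=z$ iff $\langle Tx,y\rangle=\langle x,z\rangle$ for all $x\in\operatorname{dom}(T)$. The operator $T$ is semiregular if $\operatorname{dom}(T)$ is a dense $C_0(X)$-submodule and $T^*$ is densely defined. A semiregular operator $T$ is selfadjoint if $T=T^*$; it is regular if it is closed and $I+T^*T$ has dense range. Let $\operatorname{reg}(\Lambda)$ be the set of points of $X$ having a neighbourhood on which $\Lambda$ is continuous, and let $\operatorname{ssupp}(\Lambda):=X\setminus\operatorname{reg}(\Lambda)$. Let $\operatorname{reg}_\infty(\Lambda)$ be the set of those $p\in\partial\operatorname{reg}(\Lambda)$ for which there are an open neighbourhood $U$ of $p$ and a continuous function $U\to S^1$ that coincides with $\Lambda$ on $U\cap\operatorname{reg}(\Lambda)$. Put $\operatorname{ssupp}_r(\Lambda):=\partial\operatorname{ssupp}(\Lambda)\setminus\operatorname{reg}_\infty(\Lambda)$. Let $\tilde\Lambda:X\to S^1$ be given by $\tilde\Lambda(p):=\lim_{q\to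 p,\,q\in\operatorname{reg}(\Lambda)}\Lambda(q)$ for $p\in\operatorname{reg}_\infty(\Lambda)$, and $\tilde\Lambda(p):=\Lambda(p)$ for all other $p$. Then: 1. $T_\Lambda$ is regular if and only if $(\operatorname{ssupp}\Lambda)^\circ=\operatorname{ssupp}\Lambda$. 2. $T_\Lambda$ is selfadjoint if and only if $\operatorname{ssupp}\Lambda=\operatorname{ssupp}_r\Lambda$. 3. $T_\Lambda$ is selfadjoint and regular if and only if $\Lambda$ is continuous, and $\Lambda$ is continuous if and only if $\operatorname{ssupp}\Lambda=\emptyset$. 4. $T_\Lambda^*$ is selfadjoint and regular if and only if $\tilde\Lambda$ is continuous, and $\tilde\Lambda$ is continuous if and only if $\operatorname{ssupp}\Lambda=\operatorname{reg}_\infty\Lambda$. -/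

import Mathlib

open Topology Filter Set
open scoped ZeroAtInfty ComplexOrder LinearPMap

namespace HilbertModule

section Module

variable {X H : Type*} [TopologicalSpace X] [NormedAddCommGroup H] [InnerProductSpace ℂ H]

/-- The order of the C⋆-algebra `C₀(X)`: the pointwise one. -/
noncomputable instance instPartialOrderC0 : PartialOrder C₀(X, ℂ) :=
  PartialOrder.lift (fun f : C₀(X, ℂ) => (f : X → ℂ)) DFunLike.coe_injective

/-- The module action of `C₀(X)` on `C₀(X, H)` by pointwise multiplication. -/
noncomputable instance instSMulC0 : SMul C₀(X, ℂ) C₀(X, H) where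
  smul a f :=
    { toFun := fun x => a x • f x
      continuous_toFun := (map_continuous a).smul (map_continuous f)
      zero_at_infty' := by
        simpa using (zero_at_infty a).smul (zero_at_infty f) }

@[simp] theorem c0_smul_apply (a : C₀(X, ℂ)) (f : C₀(X, H)) (x : X) : (a • f) x = a x • f x := rfl

/-- The `C₀(X)`-valued inner product `⟨f, g⟩(x) = ⟨f x, g x⟩` of `C₀(X, H)`. -/
noncomputable def c0Inner (f g : C₀(X, H)) : C₀(X, ℂ) where
  toFun x := inner ℂ (f x) (g x)
  continuous_toFun := Continuous.inner (𝕜 := ℂ) (map_continuous f) (map_continuous g)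
  zero_at_infty' := by
    simpa using Filter.Tendsto.inner (𝕜 := ℂ) (zero_at_infty f) (zero_at_infty g)

@[simp] theorem c0Inner_apply (f g : C₀(X, H)) (x : X) : c0Inner f g x = inner ℂ (f x) (g x) := rfl

theorem c0_norm_le_iff {F : Type*} [NormedAddCommGroup F] (f : C₀(X, F)) {C : ℝ} (hC : 0 ≤ C) :
    ‖f‖ ≤ C ↔ ∀ x, ‖f x‖ ≤ C := by
  rw [← ZeroAtInftyContinuousMap.norm_toBCF_eq_norm]
  exact BoundedContinuousFunction.norm_le hC

/-- The standard Hilbert C⋆-module `C₀(X, H)` over `C₀(X)`. -/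
noncomputable instance instCStarModuleC0 : CStarModule C₀(X, ℂ) C₀(X, H) where
  inner := c0Inner
  inner_add_right := by intro f g h; ext x; simp
  inner_self_nonneg := by
    intro f x
    simp
  inner_self := by
    intro f
    constructor
    · intro h
      ext x
      simpa using DFunLike.congr_fun h x
    · rintro rfl
      ext x
      simp
  inner_op_smul_right := by intro a f g; ext x; simp
  inner_smul_right_complex := by intro z f g; ext x; simp
  star_inner := by intro f g; ext x; simp
  norm_eq_sqrt_norm_inner_self := by
    intro f
    have key : ∀ x, ‖c0Inner f f x‖ = ‖f x‖ ^ 2 := by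
      intro x
      simp [inner_self_eq_norm_sq_to_K]
    apply le_antisymm
    · rw [c0_norm_le_iff f (Real.sqrt_nonneg _)]
      intro x
      apply Real.le_sqrt_of_sq_le
      rw [← key]
      exact (c0_norm_le_iff _ (norm_nonneg _)).1 le_rfl x
    · rw [Real.sqrt_le_left (norm_nonneg _), c0_norm_le_iff _ (by positivity)]
      intro x
      rw [key]
      gcongr
      exact (c0_norm_le_iff _ (norm_nonneg _)).1 le_rfl x

end Module

section Operators

variable (A : Type*) {E : Type*} [NonUnitalCommCStarAlgebra A] [PartialOrder A]
  [NormedAddCommGroup E] [NormedSpace ℂ E] [SMul A E] [CStarModule A E]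

/-- The graph of the adjoint of an operator `T` in a Hilbert C⋆-module: all pairs `(y, z)` with
`⟨T x, y⟩ = ⟨x, z⟩` for every `x` in the domain of `T`. -/
def adjointGraph (T : E →ₗ.[ℂ] E) : Submodule ℂ (E × E) where
  carrier := {p | ∀ x : T.domain, inner A (T x) p.1 = inner A (x : E) p.2}
  add_mem' := by
    intro p q hp hq x
    simp [hp x, hq x]
  zero_mem' := by
    intro x
    simp
  smul_mem' := by
    intro c p hp x
    simp [hp x]

/-- The adjoint `T⋆` of a densely defined operator `T` in a Hilbert C⋆-module: `y` belongs to its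
domain if there is `z` with `⟨T x, y⟩ = ⟨x, z⟩` for every `x` in the domain of `T`, and then
`T⋆ y = z` (`z` is unique as the domain of `T` is dense). -/
noncomputable def adjoint (T : E →ₗ.[ℂ] E) : E →ₗ.[ℂ] E := (adjointGraph A T).toLinearPMap

/-- A semiregular operator: its domain is a dense `A`-submodule and its adjoint is densely
defined. -/
structure IsSemiregular (T : E →ₗ.[ℂ] E) : Prop where
  smul_mem : ∀ (a : A) (x : E), x ∈ T.domain → a • x ∈ T.domain
  dense_domain : Dense (T.domain : Set E)
  dense_adjoint_domain : Dense ((adjoint A T).domain : Set E)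

/-- The range of `I + T⋆ T`, whose domain is `{x ∈ dom T | T x ∈ dom T⋆}`. -/
def rangeOneAddAdjointMul (T : E →ₗ.[ℂ] E) : Set E :=
  {y | ∃ (x : T.domain) (h : T x ∈ (adjoint A T).domain), y = x + adjoint A T ⟨T x, h⟩}

/-- A regular operator: closed, semiregular, and such that `I + T⋆ T` has dense range. -/
structure IsRegular (T : E →ₗ.[ℂ] E) : Prop where
  semiregular : IsSemiregular A T
  closed : T.IsClosed
  dense_range : Dense (rangeOneAddAdjointMul A T)

/-- A selfadjoint operator: semiregular with `T⋆ = T` (equality of domains included). -/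
structure IsSelfadjoint (T : E →ₗ.[ℂ] E) : Prop where
  semiregular : IsSemiregular A T
  adjoint_eq : adjoint A T = T

end Operators

section Extensions

variable {X H : Type*} [TopologicalSpace X] [NormedAddCommGroup H] [InnerProductSpace ℂ H]

/-- For an operator `S` in `H`, the set of all `(f, g)` with `f, g ∈ C₀(X, H)` such that for all
`x` one has `f x ∈ dom S` and `S (f x) = g x`. -/
def pointwiseGraph (X : Type*) [TopologicalSpace X] (S : H →ₗ.[ℂ] H) :
    Submodule ℂ (C₀(X, H) × C₀(X, H)) where
  carrier := {p | ∀ x, (p.1 x, p.2 x) ∈ S.graph}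
  add_mem' := by
    intro p q hp hq x
    exact S.graph.add_mem (hp x) (hq x)
  zero_mem' := by
    intro x
    exact S.graph.zero_mem
  smul_mem' := by
    intro c p hp x
    exact S.graph.smul_mem c (hp x)

/-- The operator `f ↦ S ∘ f` in `C₀(X, H)` with domain `C₀(X, dom S)`, where `dom S` carries the
graph norm `(‖ξ‖² + ‖S ξ‖²)^(1/2)`: a function is continuous and vanishes at infinity for the graph
norm exactly when `f` and `S ∘ f` both are continuous and vanish at infinity for the norm
of `H`. -/
noncomputable def pointwiseOp (X : Type*) [TopologicalSpace X] (S : H →ₗ.[ℂ] H) :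
    C₀(X, H) →ₗ.[ℂ] C₀(X, H) :=
  (pointwiseGraph X S).toLinearPMap

/-- The graph scalar product `⟨φ, ξ⟩ + ⟨S φ, S ξ⟩` on the domain of `S`. -/
noncomputable def graphInner (S : H →ₗ.[ℂ] H) (φ ξ : S.domain) : ℂ :=
  inner ℂ (φ : H) (ξ : H) + inner ℂ (S φ) (S ξ)

variable [CompleteSpace H]

/-- The space of solutions of `D⋆ x = z x`. -/
noncomputable def deficiencySpace (D : H →ₗ.[ℂ] H) (z : ℂ) : Submodule ℂ H where
  carrier := {x | (x, z • x) ∈ D†.graph}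
  add_mem' := by
    intro x y hx hy
    simpa [smul_add] using D†.graph.add_mem hx hy
  zero_mem' := by
    change ((0 : H), z • (0 : H)) ∈ D†.graph
    rw [smul_zero]
    exact D†.graph.zero_mem
  smul_mem' := by
    intro c x hx
    simpa [smul_comm z c x] using D†.graph.smul_mem c hx

/-- A closed, densely defined, symmetric operator with deficiency indices `(1, 1)`. -/
structure IsSymmetricOneOne (D : H →ₗ.[ℂ] H) : Prop where
  dense_domain : Dense (D.domain : Set H)
  closed : D.IsClosed
  symmetric : D.IsFormalAdjoint D
  index_plus : Module.finrank ℂ (deficiencySpace D Complex.I) = 1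
  index_minus : Module.finrank ℂ (deficiencySpace D (-Complex.I)) = 1

/-- A vector `φ` in the domain of `D_max = D⋆` with `D_max φ = z φ`, normalized in the graph
norm. -/
structure IsNormalizedDeficiencyVector (D : H →ₗ.[ℂ] H) (z : ℂ) (φ : D†.domain) : Prop where
  map_eq : D† φ = z • (φ : H)
  normalized : graphInner D† φ φ = 1

/-- The functions `f` such that for every `x` the vector `f x` lies in the domain of `D_max` and
satisfies the boundary condition `α₊ (f x) = Λ x * α₋ (f x)`, where `α₊` and `α₋` are the graph
scalar products with `φp` and `φm`. -/
def boundarySpace (D : H →ₗ.[ℂ] H) (φp φm : D†.domain) (Λ : X → Circle) :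
    Submodule ℂ C₀(X, H) where
  carrier := {f | ∀ x, ∃ ξ : D†.domain, (ξ : H) = f x ∧
    graphInner D† φp ξ = (Λ x : ℂ) * graphInner D† φm ξ}
  add_mem' := by
    intro f g hf hg x
    obtain ⟨ξ, hξ, hξ'⟩ := hf x
    obtain ⟨η, hη, hη'⟩ := hg x
    refine ⟨ξ + η, by simp [hξ, hη], ?_⟩
    simp only [graphInner, LinearPMap.map_add, Submodule.coe_add, inner_add_right] at *
    linear_combination hξ' + hη'
  zero_mem' := by
    intro x
    exact ⟨0, by simp, by simp [graphInner]⟩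
  smul_mem' := by
    intro c f hf x
    obtain ⟨ξ, hξ, hξ'⟩ := hf x
    refine ⟨c • ξ, by simp [hξ], ?_⟩
    simp only [graphInner, LinearPMap.map_smul, Submodule.coe_smul, inner_smul_right] at *
    linear_combination c * hξ'

/-- The operator `T_Λ`: the restriction of `T_max`, `(T_max f) x = D_max (f x)` with domain
`C₀(X, dom D_max)`, to the functions with `α₊ ∘ f = Λ · (α₋ ∘ f)`. -/
noncomputable def boundaryOp (D : H →ₗ.[ℂ] H) (φp φm : D†.domain) (Λ : X → Circle) :
    C₀(X, H) →ₗ.[ℂ] C₀(X, H) :=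
  (pointwiseOp X D†).domRestrict (boundarySpace D φp φm Λ)

end Extensions

section SingularSupport

variable {X : Type*} [TopologicalSpace X]

/-- The points near which `Λ` is continuous. -/
def reg (Λ : X → Circle) : Set X := {p | ∃ U ∈ 𝓝 p, ContinuousOn Λ U}

/-- The closed singular support of `Λ`. -/
def ssupp (Λ : X → Circle) : Set X := (reg Λ)ᶜ

/-- The points `p` of the boundary of `reg Λ` such that the restriction of `Λ` to `reg Λ` has a
continuous circle-valued extension to an open neighbourhood of `p`. -/
def regInfty (Λ : X → Circle) : Set X :=
  {p | p ∈ frontier (reg Λ) ∧ ∃ U : Set X, IsOpen U ∧ p ∈ U ∧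
    ∃ L : X → Circle, ContinuousOn L U ∧ EqOn L Λ (U ∩ reg Λ)}

/-- The complement of `regInfty Λ` in the boundary of the singular support. -/
def ssuppR (Λ : X → Circle) : Set X := frontier (ssupp Λ) \ regInfty Λ

open Classical in
/-- The extended function: at a point `p` of `regInfty Λ` its value is the limit of `Λ q` as
`q → p` in `reg Λ`; it equals `Λ` at all other points. -/
noncomputable def extended (Λ : X → Circle) (p : X) : Circle :=
  if p ∈ regInfty Λ then limUnder (𝓝[reg Λ] p) Λ else Λ p

end SingularSupport

end HilbertModule

/-! The engine is the boundary form (`inner_sub_inner_eq`): for `u`, `v` in the graph of `D_max`,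
the defect of symmetry is `i (conj α₋(u) α₋(v) - conj α₊(u) α₊(v))`. Hence the condition `α₊ = l α₋`
with `|l| = 1` is its own adjoint condition, and it is detected by testing against the single vector
`φ₋ + l φ₊`.

A function in `dom T_Λ` has `α₊ = α₋ = 0` on `ssupp Λ`, since wherever `α₋` is nonzero the quotient
`α₊ / α₋` shows that `Λ` is continuous nearby (`alpha_eq_zero_of_mem_ssupp`). Dually, the adjoint
keeps the boundary condition on `reg Λ` only (`mem_adjoint_boundaryOp_graph`). Continuity still
forces `α₊ = α₋ = 0` at frontier points outside `regInfty Λ`, because otherwise the normalized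
quotient would extend `Λ` continuously (`alpha_eq_zero_of_mem_frontier`). Comparing the two
descriptions settles selfadjointness.

For regularity, if `reg Λ` is clopen then `(1 + T⋆T) u = f` is solved pointwise by projecting `(f x,
0)` onto the graph of `D`, adding a rank one term on `reg Λ`. If a point `p` of `ssupp Λ` is a limit
of `reg Λ`, every value at `p` of the range of `1 + T⋆T` is orthogonal to one fixed nonzero vector.

For `T_Λ⋆`: when the extended function is continuous, `reg Λ` is dense and the adjoint is the
boundary operator of that function. Conversely, selfadjointness excludes interior points of `ssupp
Λ`, and dense range excludes frontier points outside `regInfty Λ`. -/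

namespace HilbertModule

/-! ### The Hilbert space structure on `H × H`. -/

section Pairing

variable {H : Type*} [NormedAddCommGroup H] [InnerProductSpace ℂ H]

/-- The scalar product of the orthogonal sum `H ⊕ H`. -/
noncomputable def pairing (u v : H × H) : ℂ := inner ℂ u.1 v.1 + inner ℂ u.2 v.2

theorem pairing_add_left (u v w : H × H) : pairing (u + v) w = pairing u w + pairing v w := by
  simp only [pairing, Prod.fst_add, Prod.snd_add, inner_add_left]; ring

theorem pairing_add_right (u v w : H × H) : pairing u (v + w) = pairing u v + pairing u w := by
  simp only [pairing, Prod.fst_add, Prod.snd_add, inner_add_right]; ring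

theorem pairing_sub_right (u v w : H × H) : pairing u (v - w) = pairing u v - pairing u w := by
  simp only [pairing, Prod.fst_sub, Prod.snd_sub, inner_sub_right]; ring

theorem pairing_smul_left (c : ℂ) (u v : H × H) :
    pairing (c • u) v = (starRingEnd ℂ) c * pairing u v := by
  simp only [pairing, Prod.smul_fst, Prod.smul_snd, inner_smul_left]; ring

theorem pairing_smul_right (c : ℂ) (u v : H × H) : pairing u (c • v) = c * pairing u v := by
  simp only [pairing, Prod.smul_fst, Prod.smul_snd, inner_smul_right]; ring

theorem pairing_conj_symm (u v : H × H) : (starRingEnd ℂ) (pairing v u) = pairing u v := by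
  simp only [pairing, map_add, inner_conj_symm]

theorem pairing_self (u : H × H) : pairing u u = ((‖u.1‖ ^ 2 + ‖u.2‖ ^ 2 : ℝ) : ℂ) := by
  simp [pairing, inner_self_eq_norm_sq_to_K]

theorem eq_zero_of_pairing_self {u : H × H} (h : pairing u u = 0) : u = 0 := by
  rw [pairing_self, Complex.ofReal_eq_zero] at h
  have h1 : ‖u.1‖ = 0 := by nlinarith [sq_nonneg ‖u.1‖, sq_nonneg ‖u.2‖]
  have h2 : ‖u.2‖ = 0 := by nlinarith [sq_nonneg ‖u.1‖, sq_nonneg ‖u.2‖]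
  exact Prod.ext (norm_eq_zero.1 h1) (norm_eq_zero.1 h2)

theorem pairing_eq_inner (u v : H × H) :
    pairing u v = inner ℂ (WithLp.toLp 2 u) (WithLp.toLp 2 v) := by
  simp [pairing, WithLp.prod_inner_apply]

@[fun_prop]
theorem continuous_pairing {Y : Type*} [TopologicalSpace Y] {f g : Y → H × H}
    (hf : Continuous f) (hg : Continuous g) : Continuous fun y => pairing (f y) (g y) :=
  (hf.fst.inner (𝕜 := ℂ) hg.fst).add (hf.snd.inner (𝕜 := ℂ) hg.snd)

/-- The orthogonal projection onto a closed subspace of `H ⊕ H`. -/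
theorem exists_projection [CompleteSpace H] (G : Submodule ℂ (H × H))
    (hG : IsClosed (G : Set (H × H))) :
    ∃ Q : H × H →L[ℂ] H × H, ∀ v, Q v ∈ G ∧ ∀ u ∈ G, pairing u (v - Q v) = 0 := by
  let e : WithLp 2 (H × H) ≃L[ℂ] H × H := WithLp.prodContinuousLinearEquiv 2 ℂ H H
  let K : Submodule ℂ (WithLp 2 (H × H)) := G.comap (e : WithLp 2 (H × H) →ₗ[ℂ] H × H)
  have hK : IsClosed (K : Set (WithLp 2 (H × H))) := hG.preimage e.continuous
  have : CompleteSpace K := hK.completeSpace_coe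
  refine ⟨(e : WithLp 2 (H × H) →L[ℂ] H × H) ∘L K.starProjection ∘L
    (e.symm : H × H →L[ℂ] WithLp 2 (H × H)), fun v => ⟨?_, fun u hu => ?_⟩⟩
  · exact K.starProjection_apply_mem (e.symm v)
  · rw [pairing_eq_inner]
    have := K.sub_starProjection_mem_orthogonal (e.symm v)
    exact this (e.symm u) hu

end Pairing

/-! ### Graphs of `D` and `D†`, and deficiency vectors. -/

section Symmetric

variable {H : Type*} [NormedAddCommGroup H] [InnerProductSpace ℂ H] [CompleteSpace H]
  {D : H →ₗ.[ℂ] H}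

theorem mem_adjoint_graph_iff (hD : Dense (D.domain : Set H)) (v : H × H) :
    v ∈ D†.graph ↔ ∀ u ∈ D.graph, inner ℂ u.2 v.1 = inner ℂ u.1 v.2 := by
  rw [LinearPMap.adjoint_graph_eq_graph_adjoint hD, Submodule.mem_adjoint_iff]
  simp only [sub_eq_zero, Prod.forall]

/-- The orthogonal complement of the graph of `D` is the graph of the adjoint, rotated by a quarter
turn. -/
theorem mem_adjoint_graph_iff_pairing (hD : Dense (D.domain : Set H)) (v : H × H) :
    (v.2, -v.1) ∈ D†.graph ↔ ∀ u ∈ D.graph, pairing u v = 0 := by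
  rw [mem_adjoint_graph_iff hD]
  refine forall₂_congr fun u _ => ?_
  simp only [pairing, inner_neg_right]
  constructor <;> intro h <;> linear_combination h

namespace IsSymmetricOneOne

theorem graph_le (hD : IsSymmetricOneOne D) : D.graph ≤ D†.graph :=
  LinearPMap.le_graph_of_le (LinearPMap.IsFormalAdjoint.le_adjoint hD.dense_domain hD.symmetric)

theorem isClosed_adjoint_graph (hD : IsSymmetricOneOne D) :
    IsClosed (D†.graph : Set (H × H)) :=
  LinearPMap.adjoint_isClosed hD.dense_domain

end IsSymmetricOneOne

namespace IsNormalizedDeficiencyVector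

variable {z : ℂ} {φ : D†.domain}

theorem mem_graph (hφ : IsNormalizedDeficiencyVector D z φ) :
    ((φ : H), z • (φ : H)) ∈ D†.graph := by
  rw [← hφ.map_eq]
  exact D†.mem_graph φ

theorem graphInner_eq (hφ : IsNormalizedDeficiencyVector D z φ) (ξ : D†.domain) :
    graphInner D† φ ξ = pairing ((φ : H), z • (φ : H)) ((ξ : H), D† ξ) := by
  rw [graphInner, hφ.map_eq]; rfl

theorem pairing_self_eq_one (hφ : IsNormalizedDeficiencyVector D z φ) :
    pairing ((φ : H), z • (φ : H)) ((φ : H), z • (φ : H)) = 1 := by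
  have h := hφ.normalized
  rwa [hφ.graphInner_eq, hφ.map_eq] at h

theorem coe_ne_zero (hφ : IsNormalizedDeficiencyVector D z φ) : (φ : H) ≠ 0 := by
  intro h
  have := hφ.pairing_self_eq_one
  simp [h, pairing] at this

theorem exists_smul_eq (hφ : IsNormalizedDeficiencyVector D z φ)
    (hz : Module.finrank ℂ (deficiencySpace D z) = 1) {η : H} (hη : (η, z • η) ∈ D†.graph) :
    ∃ c : ℂ, η = c • (φ : H) := by
  have hne : (⟨(φ : H), hφ.mem_graph⟩ : deficiencySpace D z) ≠ 0 := fun h =>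
    hφ.coe_ne_zero (congrArg Subtype.val h)
  obtain ⟨c, hc⟩ := (finrank_eq_one_iff_of_nonzero' _ hne).1 hz ⟨η, hη⟩
  exact ⟨c, (congrArg Subtype.val hc).symm⟩

/-- As `z² = -1`, rotating `(φ, z φ)` only multiplies it by `z`, so the rotated vector is still in
the graph of `D†`. -/
theorem pairing_eq_zero_of_mem_graph (hD : Dense (D.domain : Set H))
    (hφ : IsNormalizedDeficiencyVector D z φ) (hz : z * z = -1) {u : H × H} (hu : u ∈ D.graph) :
    pairing ((φ : H), z • (φ : H)) u = 0 := by
  rw [← pairing_conj_symm, (mem_adjoint_graph_iff_pairing hD _).1 _ u hu, map_zero]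
  have : (z • (φ : H), -(φ : H)) = z • ((φ : H), z • (φ : H)) := by
    rw [Prod.smul_mk, smul_smul, hz, neg_one_smul]
  exact this ▸ D†.graph.smul_mem z hφ.mem_graph

end IsNormalizedDeficiencyVector

end Symmetric

/-! ### Boundary functionals, von Neumann's formula and the boundary form. -/

section BoundaryForm

variable {H : Type*} [NormedAddCommGroup H] [InnerProductSpace ℂ H]

/-- The boundary functional `α₊`, in terms of the pairs `(ξ, D_max ξ)`. -/
noncomputable def alphaPlus (φ : H) (v : H × H) : ℂ := pairing (φ, Complex.I • φ) v

/-- The boundary functional `α₋`, in terms of the pairs `(ξ, D_max ξ)`. -/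
noncomputable def alphaMinus (φ : H) (v : H × H) : ℂ := pairing (φ, -Complex.I • φ) v

@[fun_prop]
theorem continuous_alphaPlus {Y : Type*} [TopologicalSpace Y] (φ : H) {f : Y → H × H}
    (hf : Continuous f) : Continuous fun y => alphaPlus φ (f y) :=
  continuous_pairing continuous_const hf

@[fun_prop]
theorem continuous_alphaMinus {Y : Type*} [TopologicalSpace Y] (φ : H) {f : Y → H × H}
    (hf : Continuous f) : Continuous fun y => alphaMinus φ (f y) :=
  continuous_pairing continuous_const hf

/-- The pair `(ξ, D_max ξ)` of the vector `ξ = φ₋ + l φ₊`, which spans modulo `dom D` the domain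
of the extension of `D` with boundary condition `α₊ = l α₋`. -/
noncomputable def boundaryVector (φp φm : H) (l : ℂ) : H × H :=
  (φm, -Complex.I • φm) + l • (φp, Complex.I • φp)

theorem pairing_boundaryVector (φp φm : H) (l : ℂ) (v : H × H) :
    pairing (boundaryVector φp φm l) v =
      alphaMinus φm v + (starRingEnd ℂ) l * alphaPlus φp v := by
  rw [boundaryVector, pairing_add_left, pairing_smul_left]; rfl

theorem pairing_deficiencyVectors (φp φm : H) :
    pairing (φp, Complex.I • φp) (φm, -Complex.I • φm) = 0 := by
  simp only [pairing, inner_smul_left, inner_smul_right, Complex.conj_I]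
  linear_combination (inner ℂ φp φm) * Complex.I_mul_I

variable [CompleteSpace H] {D : H →ₗ.[ℂ] H} {φp φm : D†.domain}

theorem alphaPlus_boundaryVector (hφp : IsNormalizedDeficiencyVector D Complex.I φp) (φm : H)
    (l : ℂ) : alphaPlus (φp : H) (boundaryVector φp φm l) = l := by
  rw [alphaPlus, boundaryVector, pairing_add_right, pairing_smul_right, pairing_deficiencyVectors,
    hφp.pairing_self_eq_one]
  ring

theorem alphaMinus_boundaryVector (hφm : IsNormalizedDeficiencyVector D (-Complex.I) φm) (φp : H)
    (l : ℂ) : alphaMinus (φm : H) (boundaryVector φp φm l) = 1 := by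
  rw [alphaMinus, boundaryVector, pairing_add_right, pairing_smul_right, hφm.pairing_self_eq_one,
    ← pairing_conj_symm, pairing_deficiencyVectors, map_zero]
  ring

theorem boundaryVector_mem_graph (hφp : IsNormalizedDeficiencyVector D Complex.I φp)
    (hφm : IsNormalizedDeficiencyVector D (-Complex.I) φm) (l : ℂ) :
    boundaryVector (φp : H) φm l ∈ D†.graph :=
  D†.graph.add_mem hφm.mem_graph (D†.graph.smul_mem l hφp.mem_graph)

theorem alphaPlus_eq_zero_of_mem_graph (hD : IsSymmetricOneOne D)
    (hφp : IsNormalizedDeficiencyVector D Complex.I φp) {u : H × H} (hu : u ∈ D.graph) :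
    alphaPlus (φp : H) u = 0 :=
  hφp.pairing_eq_zero_of_mem_graph hD.dense_domain Complex.I_mul_I hu

theorem alphaMinus_eq_zero_of_mem_graph (hD : IsSymmetricOneOne D)
    (hφm : IsNormalizedDeficiencyVector D (-Complex.I) φm) {u : H × H} (hu : u ∈ D.graph) :
    alphaMinus (φm : H) u = 0 :=
  hφm.pairing_eq_zero_of_mem_graph hD.dense_domain
    (by linear_combination Complex.I_mul_I) hu

/-- Von Neumann's formula: the graph orthogonal complement of `D` in `D_max`. -/
theorem exists_eq_of_orthogonal (hD : IsSymmetricOneOne D)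
    (hφp : IsNormalizedDeficiencyVector D Complex.I φp)
    (hφm : IsNormalizedDeficiencyVector D (-Complex.I) φm) {v : H × H} (hv : v ∈ D†.graph)
    (h : ∀ u ∈ D.graph, pairing u v = 0) :
    ∃ c d : ℂ, v = c • ((φp : H), Complex.I • (φp : H)) +
      d • ((φm : H), -Complex.I • (φm : H)) := by
  have hw := (mem_adjoint_graph_iff_pairing hD.dense_domain v).2 h
  -- Both `v` and its rotation lie in the graph of `D†`; combining them with `z = ±i` yields the
  -- deficiency vectors `v.1 ∓ i v.2`, from which `v.1` and `v.2` are recovered.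
  have key : ∀ z : ℂ, z * z = -1 →
      (v.1 - z • v.2, z • (v.1 - z • v.2)) ∈ D†.graph := by
    intro z hz
    have := D†.graph.sub_mem hv (D†.graph.smul_mem z hw)
    convert this using 1
    refine Prod.ext rfl ?_
    simp only [Prod.snd_sub, Prod.smul_snd, smul_sub, smul_smul, hz, smul_neg]
    module
  obtain ⟨c, hc⟩ := hφp.exists_smul_eq hD.index_plus (key _ Complex.I_mul_I)
  obtain ⟨d, hd⟩ := hφm.exists_smul_eq hD.index_minus
    (key (-Complex.I) (by linear_combination Complex.I_mul_I))
  have hI : (Complex.I / 2) * (-Complex.I - Complex.I) = 1 := by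
    linear_combination -Complex.I_mul_I
  refine ⟨c / 2, d / 2, Prod.ext ?_ ?_⟩
  · have : v.1 = (1 / 2 : ℂ) • ((v.1 - Complex.I • v.2) + (v.1 - (-Complex.I) • v.2)) := by
      module
    rw [this, hc, hd]
    simp only [Prod.fst_add, Prod.smul_fst]
    module
  · have : v.2 = (Complex.I / 2 : ℂ) • ((v.1 - Complex.I • v.2) - (v.1 - (-Complex.I) • v.2)) := by
      calc v.2 = ((Complex.I / 2) * (-Complex.I - Complex.I)) • v.2 := by rw [hI, one_smul]
        _ = _ := by module
    rw [this, hc, hd]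
    simp only [Prod.snd_add, Prod.smul_snd]
    module

/-- The part of `v` orthogonal to the graph of `D` is a combination of the two deficiency vectors
and is orthogonal to both, hence zero. -/
theorem mem_graph_of_alpha_eq_zero (hD : IsSymmetricOneOne D)
    (hφp : IsNormalizedDeficiencyVector D Complex.I φp)
    (hφm : IsNormalizedDeficiencyVector D (-Complex.I) φm) {v : H × H} (hv : v ∈ D†.graph)
    (hp : alphaPlus (φp : H) v = 0) (hm : alphaMinus (φm : H) v = 0) : v ∈ D.graph := by
  obtain ⟨Q, hQ⟩ := exists_projection D.graph hD.closed
  obtain ⟨hu, ho⟩ := hQ v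
  obtain ⟨c, d, hcd⟩ := exists_eq_of_orthogonal hD hφp hφm
    (D†.graph.sub_mem hv (hD.graph_le hu)) ho
  have h0 : v - Q v = 0 := by
    apply eq_zero_of_pairing_self
    have h1 := alphaPlus_eq_zero_of_mem_graph hD hφp hu
    have h2 := alphaMinus_eq_zero_of_mem_graph hD hφm hu
    simp only [alphaPlus, alphaMinus] at h1 h2 hp hm
    nth_rw 1 [hcd]
    rw [pairing_add_left, pairing_smul_left, pairing_smul_left, pairing_sub_right,
      pairing_sub_right, h1, h2, hp, hm]
    simp
  rw [sub_eq_zero.1 h0]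
  exact hu

/-- The boundary form of `D_max`. -/
theorem inner_sub_inner_eq (hD : IsSymmetricOneOne D)
    (hφp : IsNormalizedDeficiencyVector D Complex.I φp)
    (hφm : IsNormalizedDeficiencyVector D (-Complex.I) φm) {u v : H × H} (hu : u ∈ D†.graph)
    (hv : v ∈ D†.graph) :
    inner ℂ u.2 v.1 - inner ℂ u.1 v.2 =
      Complex.I * ((starRingEnd ℂ) (alphaMinus (φm : H) u) * alphaMinus (φm : H) v -
        (starRingEnd ℂ) (alphaPlus (φp : H) u) * alphaPlus (φp : H) v) := by
  set P : H × H := ((φp : H), Complex.I • (φp : H)) with hP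
  set M : H × H := ((φm : H), -Complex.I • (φm : H)) with hM
  -- Removing the deficiency components leaves a vector in the graph of `D`, which contributes
  -- nothing to the form; the rest is explicit.
  set a : H × H := v - (alphaPlus (φp : H) v • P + alphaMinus (φm : H) v • M) with ha
  have hPM : pairing P M = 0 := pairing_deficiencyVectors _ _
  have hMP : pairing M P = 0 := by rw [← pairing_conj_symm, hPM, map_zero]
  have hadom : a ∈ D.graph := by
    refine mem_graph_of_alpha_eq_zero hD hφp hφm (D†.graph.sub_mem hv (D†.graph.add_mem
      (D†.graph.smul_mem _ hφp.mem_graph) (D†.graph.smul_mem _ hφm.mem_graph))) ?_ ?_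
    · change pairing P _ = 0
      rw [ha, pairing_sub_right, pairing_add_right, pairing_smul_right, pairing_smul_right, hPM,
        hφp.pairing_self_eq_one]
      simp [alphaPlus, hP]
    · change pairing M _ = 0
      rw [ha, pairing_sub_right, pairing_add_right, pairing_smul_right, pairing_smul_right, hMP,
        hφm.pairing_self_eq_one]
      simp [alphaMinus, hM]
  have h0 : inner ℂ u.2 a.1 = inner ℂ u.1 a.2 := by
    have := (mem_adjoint_graph_iff hD.dense_domain u).1 hu a hadom
    rw [← inner_conj_symm, ← this, inner_conj_symm]
  have hv' : v = a + (alphaPlus (φp : H) v • P + alphaMinus (φm : H) v • M) := by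
    rw [ha]; abel
  have cP : (starRingEnd ℂ) (alphaPlus (φp : H) u) =
      inner ℂ u.1 (φp : H) + Complex.I * inner ℂ u.2 (φp : H) := by
    rw [alphaPlus, pairing_conj_symm, pairing, inner_smul_right]
  have cM : (starRingEnd ℂ) (alphaMinus (φm : H) u) =
      inner ℂ u.1 (φm : H) + -Complex.I * inner ℂ u.2 (φm : H) := by
    rw [alphaMinus, pairing_conj_symm, pairing, inner_smul_right]
  rw [cP, cM]
  generalize alphaPlus (φp : H) v = x at *
  generalize alphaMinus (φm : H) v = y at *
  rw [hv']
  simp only [hP, hM, Prod.fst_add, Prod.snd_add, Prod.smul_fst, Prod.smul_snd, inner_add_right,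
    inner_smul_right]
  linear_combination h0 + (x * inner ℂ u.2 (φp : H) + y * inner ℂ u.2 (φm : H)) * Complex.I_mul_I

end BoundaryForm

/-! ### Cutoffs and density in `C₀(X, H)`. -/

section ContinuousFunctions

variable {X H : Type*} [TopologicalSpace X] [NormedAddCommGroup H]

theorem norm_apply_le_norm (f : C₀(X, H)) (x : X) : ‖f x‖ ≤ ‖f‖ :=
  (c0_norm_le_iff f (norm_nonneg f)).1 le_rfl x

theorem continuous_eval_c0 (x : X) : Continuous fun f : C₀(X, H) => f x :=
  (LipschitzWith.of_dist_le_mul (K := 1) fun f g => by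
    simpa [dist_eq_norm] using norm_apply_le_norm (f - g) x).continuous

theorem continuous_pair (p : C₀(X, H) × C₀(X, H)) : Continuous fun x => (p.1 x, p.2 x) :=
  (map_continuous p.1).prodMk (map_continuous p.2)

variable [InnerProductSpace ℂ H] [T2Space X] [LocallyCompactSpace X]

/-- A bump function at `p` supported in `V` cuts off continuous functions on `V`. -/
theorem exists_bump {V : Set X} (hV : IsOpen V) {p : X} (hp : p ∈ V) :
    ∃ b : X → ℝ, b p = 1 ∧ (∀ x ∉ V, b x = 0) ∧
      ∀ F : X → H, ContinuousOn F V → ∃ f : C₀(X, H), ∀ x, f x = (b x : ℂ) • F x := by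
  obtain ⟨K, hK, hpK, hKV⟩ := exists_compact_subset hV hp
  obtain ⟨b, hb1, hb0, hbc, -⟩ := exists_continuous_one_zero_of_isCompact (isCompact_singleton (x := p))
    isOpen_interior.isClosed_compl (disjoint_compl_right_iff_subset.2 (singleton_subset_iff.2 hpK))
  have hbK : tsupport b ⊆ K := by
    refine closure_minimal (fun x hx => ?_) hK.isClosed
    by_contra h
    exact hx (hb0 fun h' => h (interior_subset h'))
  refine ⟨b, hb1 rfl, fun x hx => image_eq_zero_of_notMem_tsupport fun h => hx (hKV (hbK h)),
    fun F hF => ?_⟩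
  have hsupp : Function.support (fun x => (b x : ℂ) • F x) ⊆ Function.support b := by
    intro x hx hx'
    exact hx (by simp [hx'])
  have hcont : Continuous fun x => (b x : ℂ) • F x :=
    ContinuousOn.continuous_of_tsupport_subset
      ((Complex.continuous_ofReal.comp (map_continuous b)).continuousOn.smul hF) hV
      ((closure_mono hsupp).trans (hbK.trans hKV))
  have hcomp : HasCompactSupport fun x => (b x : ℂ) • F x := hbc.mono hsupp
  exact ⟨⟨⟨_, hcont⟩, hcomp.is_zero_at_infty⟩, fun x => rfl⟩

/-- Functions with values in the domain of a densely defined operator are dense. -/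
theorem dense_setOf_exists_mem (G : Submodule ℂ (H × H)) (hG : Dense (Prod.fst '' (G : Set (H × H)))) :
    Dense {f : C₀(X, H) | ∃ g : C₀(X, H), ∀ x, (f x, g x) ∈ G} := by
  intro f
  rw [Metric.mem_closure_iff]
  intro ε hε
  -- A continuous selection of this convex-valued map on the compactification gives the approximant
  -- together with its image; the value `{0}` at infinity makes both vanish there.
  let t : OnePoint X → Set (H × H) := fun y =>
    y.elim {0} fun x => {c | c ∈ G ∧ ‖c.1 - f x‖ < ε / 2}
  have ht : ∀ y, Convex ℝ (t y) := by
    intro y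
    induction y using OnePoint.rec with
    | infty => exact convex_singleton _
    | coe x =>
      have h1 : Convex ℝ (G : Set (H × H)) := (G.restrictScalars ℝ).convex
      have h2 : Convex ℝ ((LinearMap.fst ℝ H H) ⁻¹' Metric.ball (f x) (ε / 2)) :=
        (convex_ball _ _).linear_preimage _
      convert h1.inter h2 using 1
      ext c
      simp [t, dist_eq_norm]
  have hloc : ∀ y, ∃ c, ∀ᶠ y' in 𝓝 y, c ∈ t y' := by
    intro y
    induction y using OnePoint.rec with
    | infty =>
      refine ⟨0, ?_⟩
      rw [OnePoint.nhds_infty_eq, eventually_sup, eventually_pure, eventually_map]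
      refine ⟨?_, by simp [t]⟩
      have h0 := zero_at_infty f
      rw [Metric.tendsto_nhds] at h0
      rw [Filter.coclosedCompact_eq_cocompact]
      filter_upwards [h0 (ε / 2) (by positivity)] with x hx
      simpa [t] using hx
    | coe x =>
      obtain ⟨a, ⟨c, hc, rfl⟩, hca⟩ := Metric.mem_closure_iff.1 (hG (f x)) (ε / 2) (by positivity)
      refine ⟨c, ?_⟩
      rw [OnePoint.nhds_coe_eq, eventually_map]
      have hco : Continuous fun x' => ‖c.1 - f x'‖ := (continuous_const.sub (map_continuous f)).norm
      have : ‖c.1 - f x‖ < ε / 2 := by rwa [← dist_eq_norm, dist_comm]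
      filter_upwards [hco.continuousAt.eventually_lt continuousAt_const this] with x' hx'
      exact ⟨hc, hx'⟩
  obtain ⟨g, hg⟩ := exists_continuous_forall_mem_convex_of_local_const ht hloc
  have hginf : g OnePoint.infty = 0 := hg OnePoint.infty
  have hlim : Tendsto (fun x : X => g x) (cocompact X) (𝓝 0) := by
    rw [← hginf, ← Filter.coclosedCompact_eq_cocompact]
    exact ((map_continuous g).tendsto _).comp OnePoint.tendsto_coe_infty
  have hcont : Continuous fun x : X => g x := (map_continuous g).comp OnePoint.continuous_coe
  let u : C₀(X, H) := ⟨⟨fun x => (g x).1, hcont.fst⟩, (continuous_fst.tendsto (0 : H × H)).comp hlim⟩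
  let v : C₀(X, H) := ⟨⟨fun x => (g x).2, hcont.snd⟩, (continuous_snd.tendsto (0 : H × H)).comp hlim⟩
  refine ⟨u, ⟨v, fun x => (hg x).1⟩, ?_⟩
  rw [dist_eq_norm]
  refine lt_of_le_of_lt ((c0_norm_le_iff _ (by positivity : (0 : ℝ) ≤ ε / 2)).2 fun x => ?_)
    (half_lt_self hε)
  have := (hg x).2.le
  rw [← norm_neg]
  simpa [u] using this

/-- Evaluation at `p` is continuous, and a bump function times `w` takes the value `w` at `p`. -/
theorem not_dense_of_inner_eq_zero {R : Set C₀(X, H)} (p : X) {w : H} (hw : w ≠ 0)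
    (h : ∀ y ∈ R, inner ℂ w (y p) = 0) : ¬ Dense R := by
  intro hR
  obtain ⟨b, hb1, -, hb⟩ := exists_bump (H := H) isOpen_univ (mem_univ p)
  obtain ⟨f, hf⟩ := hb (fun _ => w) continuousOn_const
  have hc : Continuous fun y : C₀(X, H) => inner ℂ w (y p) :=
    Continuous.inner (𝕜 := ℂ) continuous_const (continuous_eval_c0 p)
  have : inner ℂ w (f p) = 0 :=
    congrFun (hc.ext_on hR continuous_const (g := fun _ => 0) fun y hy => h y hy) f
  rw [hf, hb1] at this
  simp [hw] at this

end ContinuousFunctions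

/-! ### Pointwise descriptions of the operator graphs. -/

section Graphs

variable {X H : Type*} [TopologicalSpace X] [NormedAddCommGroup H] [InnerProductSpace ℂ H]

theorem mem_graph_domRestrict {E : Type*} [AddCommGroup E] [Module ℂ E] (T : E →ₗ.[ℂ] E)
    (S : Submodule ℂ E) (p : E × E) : p ∈ (T.domRestrict S).graph ↔ p.1 ∈ S ∧ p ∈ T.graph := by
  constructor
  · intro h
    exact ⟨(LinearPMap.mem_domain_of_mem_graph h).1,
      LinearPMap.le_graph_of_le LinearPMap.domRestrict_le h⟩
  · rintro ⟨hS, hT⟩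
    have hd : p.1 ∈ (T.domRestrict S).domain := ⟨hS, LinearPMap.mem_domain_of_mem_graph hT⟩
    have h1 := (T.domRestrict S).mem_graph ⟨p.1, hd⟩
    have h2 := LinearPMap.mem_graph_snd_inj T
      (LinearPMap.le_graph_of_le LinearPMap.domRestrict_le h1) hT rfl
    have h3 : (p.1, T.domRestrict S ⟨p.1, hd⟩) = p := Prod.ext rfl h2
    rwa [h3] at h1

theorem mem_pointwiseOp_graph (S : H →ₗ.[ℂ] H) (p : C₀(X, H) × C₀(X, H)) :
    p ∈ (pointwiseOp X S).graph ↔ ∀ x, (p.1 x, p.2 x) ∈ S.graph := by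
  rw [pointwiseOp, Submodule.toLinearPMap_graph_eq]
  · rfl
  · intro q hq h0
    ext x
    refine LinearPMap.graph_fst_eq_zero_snd S (hq x) ?_
    rw [h0]; rfl

theorem mem_adjointGraph_iff (T : C₀(X, H) →ₗ.[ℂ] C₀(X, H)) (q : C₀(X, H) × C₀(X, H)) :
    q ∈ adjointGraph C₀(X, ℂ) T ↔
      ∀ p ∈ T.graph, ∀ x, inner ℂ (p.2 x) (q.1 x) = inner ℂ (p.1 x) (q.2 x) := by
  constructor
  · rintro h p hp x
    obtain ⟨y, h1, h2⟩ := (LinearPMap.mem_graph_iff T).1 hp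
    rw [← h1, ← h2]
    exact DFunLike.congr_fun (h y) x
  · intro h y
    ext x
    exact h _ (T.mem_graph y) x

/-- `toLinearPMap` recovers a graph only if it is single-valued, and density of the domain ensures
this. -/
theorem adjoint_graph_eq {T : C₀(X, H) →ₗ.[ℂ] C₀(X, H)} (hT : Dense (T.domain : Set C₀(X, H))) :
    (adjoint C₀(X, ℂ) T).graph = adjointGraph C₀(X, ℂ) T := by
  refine Submodule.toLinearPMap_graph_eq _ fun q hq h0 => ?_
  rw [mem_adjointGraph_iff] at hq
  ext x
  have hc : Continuous fun f : C₀(X, H) => inner ℂ (f x) (q.2 x) :=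
    Continuous.inner (𝕜 := ℂ) (continuous_eval_c0 x) continuous_const
  have : (fun f : C₀(X, H) => inner ℂ (f x) (q.2 x)) = fun _ => 0 := by
    refine hc.ext_on hT continuous_const fun f hf => ?_
    have := hq _ (T.mem_graph ⟨f, hf⟩) x
    rw [h0] at this
    simpa using this.symm
  exact inner_self_eq_zero.1 (congrFun this q.2)

theorem mem_rangeOneAddAdjointMul_iff {A E : Type*} [NonUnitalCommCStarAlgebra A] [PartialOrder A]
    [NormedAddCommGroup E] [NormedSpace ℂ E] [SMul A E] [CStarModule A E] (T : E →ₗ.[ℂ] E) (y : E) :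
    y ∈ rangeOneAddAdjointMul A T ↔
      ∃ f g h, (f, g) ∈ T.graph ∧ (g, h) ∈ (adjoint A T).graph ∧ y = f + h := by
  constructor
  · rintro ⟨x, hx, rfl⟩
    exact ⟨x, T x, _, T.mem_graph x, (adjoint A T).mem_graph ⟨T x, hx⟩, rfl⟩
  · rintro ⟨f, g, h, hfg, hgh, rfl⟩
    obtain ⟨x, rfl, rfl⟩ := (LinearPMap.mem_graph_iff T).1 hfg
    obtain ⟨z, h1, rfl⟩ := (LinearPMap.mem_graph_iff _).1 hgh
    have hz : T x ∈ (adjoint A T).domain := LinearPMap.mem_domain_of_mem_graph hgh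
    exact ⟨x, hz, by congr 2; exact Subtype.ext h1⟩

theorem mem_boundaryOp_graph [CompleteSpace H] {D : H →ₗ.[ℂ] H} {φp φm : D†.domain}
    (hφp : IsNormalizedDeficiencyVector D Complex.I φp)
    (hφm : IsNormalizedDeficiencyVector D (-Complex.I) φm) (Λ : X → Circle)
    (p : C₀(X, H) × C₀(X, H)) :
    p ∈ (boundaryOp D φp φm Λ).graph ↔ ∀ x, (p.1 x, p.2 x) ∈ D†.graph ∧
      alphaPlus (φp : H) (p.1 x, p.2 x) = Λ x * alphaMinus (φm : H) (p.1 x, p.2 x) := by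
  rw [boundaryOp, mem_graph_domRestrict, mem_pointwiseOp_graph]
  constructor
  · rintro ⟨h1, h2⟩ x
    refine ⟨h2 x, ?_⟩
    obtain ⟨ξ, hξ, h⟩ := h1 x
    have hv : p.2 x = D† ξ :=
      LinearPMap.mem_graph_snd_inj _ (h2 x) (D†.mem_graph ξ) hξ.symm
    rw [hφp.graphInner_eq, hφm.graphInner_eq] at h
    rw [← hξ, hv]
    exact h
  · intro h
    refine ⟨fun x => ?_, fun x => (h x).1⟩
    obtain ⟨ξ, h1, h2⟩ := (LinearPMap.mem_graph_iff _).1 (h x).1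
    refine ⟨ξ, h1, ?_⟩
    rw [hφp.graphInner_eq, hφm.graphInner_eq]
    have hx : ((ξ : H), D† ξ) = (p.1 x, p.2 x) := Prod.ext h1 h2
    rw [hx]
    exact (h x).2

end Graphs

/-! ### Topology of the singular support and of the extended function. -/

section SingularSupportLemmas

variable {X : Type*} [TopologicalSpace X] {Λ : X → Circle}

theorem mem_reg_of_continuousOn {V : Set X} (hV : IsOpen V) (h : ContinuousOn Λ V) {p : X}
    (hp : p ∈ V) : p ∈ reg Λ :=
  ⟨V, hV.mem_nhds hp, h⟩

theorem isOpen_reg (Λ : X → Circle) : IsOpen (reg Λ) := by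
  rw [isOpen_iff_mem_nhds]
  rintro p ⟨U, hU, hc⟩
  filter_upwards [eventually_mem_nhds_iff.2 hU] with q hq
  exact ⟨U, hq, hc⟩

theorem continuousOn_reg (Λ : X → Circle) : ContinuousOn Λ (reg Λ) := by
  rintro p ⟨U, hU, hc⟩
  exact (hc.continuousAt hU).continuousWithinAt

theorem isClosed_ssupp (Λ : X → Circle) : IsClosed (ssupp Λ) := (isOpen_reg Λ).isClosed_compl

theorem frontier_ssupp (Λ : X → Circle) : frontier (ssupp Λ) = frontier (reg Λ) :=
  frontier_compl _

theorem frontier_reg_subset_ssupp (Λ : X → Circle) : frontier (reg Λ) ⊆ ssupp Λ := by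
  rw [← frontier_ssupp]
  exact (isClosed_ssupp Λ).frontier_subset

theorem regInfty_subset_ssupp (Λ : X → Circle) : regInfty Λ ⊆ ssupp Λ := fun _ hp =>
  frontier_reg_subset_ssupp Λ hp.1

theorem mem_frontier_reg_of_notMem_interior {p : X} (hp : p ∈ ssupp Λ)
    (h : p ∉ interior (ssupp Λ)) : p ∈ frontier (reg Λ) := by
  rw [← frontier_ssupp, (isClosed_ssupp Λ).frontier_eq]
  exact ⟨hp, h⟩

theorem continuous_iff_ssupp_eq_empty : Continuous Λ ↔ ssupp Λ = ∅ := by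
  rw [ssupp, compl_empty_iff]
  constructor
  · intro h
    exact eq_univ_of_forall fun p => ⟨univ, univ_mem, h.continuousOn⟩
  · intro h
    have := continuousOn_reg Λ
    rwa [h, continuousOn_univ] at this

theorem extended_eq_of_notMem_regInfty {p : X} (hp : p ∉ regInfty Λ) : extended Λ p = Λ p :=
  if_neg hp

theorem extended_eq_of_mem_reg {p : X} (hp : p ∈ reg Λ) : extended Λ p = Λ p :=
  extended_eq_of_notMem_regInfty fun h => regInfty_subset_ssupp Λ h hp

/-- At a point of `regInfty Λ` the limit exists and is unique because `Λ` agrees on `reg Λ` with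
`L`, which is continuous at the point. -/
theorem extended_eq_of_continuousOn {U : Set X} (hU : IsOpen U) {L : X → Circle}
    (hL : ContinuousOn L U) (hLΛ : EqOn L Λ (U ∩ reg Λ)) {p : X} (hpU : p ∈ U)
    (hp : p ∈ closure (reg Λ)) (h : p ∈ reg Λ ∨ p ∈ regInfty Λ) : extended Λ p = L p := by
  by_cases hr : p ∈ reg Λ
  · rw [extended_eq_of_mem_reg hr, hLΛ ⟨hpU, hr⟩]
  · have hi : p ∈ regInfty Λ := h.resolve_left hr
    have : (𝓝[reg Λ] p).NeBot := mem_closure_iff_nhdsWithin_neBot.1 hp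
    rw [extended, if_pos hi]
    refine Tendsto.limUnder_eq ?_
    refine Tendsto.congr' ?_ ((hL.continuousAt (hU.mem_nhds hpU)).tendsto.mono_left
      nhdsWithin_le_nhds)
    filter_upwards [mem_nhdsWithin_of_mem_nhds (hU.mem_nhds hpU), self_mem_nhdsWithin] with q h1 h2
    exact hLΛ ⟨h1, h2⟩

/-- On the interior of `ssupp Λ` the extended function is `Λ` itself, so its continuity leaves no
interior points; at the remaining ones it is its own witness for `regInfty Λ`. Conversely, it agrees
with each local extension on a whole neighbourhood, as every point is in `reg Λ` or `regInfty Λ`. -/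
theorem continuous_extended_iff : Continuous (extended Λ) ↔ ssupp Λ = regInfty Λ := by
  constructor
  · intro h
    refine Subset.antisymm (fun p hp => ?_) (regInfty_subset_ssupp Λ)
    have hfr : p ∈ frontier (reg Λ) := by
      refine mem_frontier_reg_of_notMem_interior hp fun hint => ?_
      refine hp (mem_reg_of_continuousOn isOpen_interior (h.continuousOn.congr fun q hq => ?_) hint)
      refine (extended_eq_of_notMem_regInfty fun hq' => ?_).symm
      have := hq'.1
      rw [← frontier_ssupp] at this
      exact this.2 hq
    exact ⟨hfr, univ, isOpen_univ, mem_univ p, extended Λ, h.continuousOn,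
      fun q hq => extended_eq_of_mem_reg hq.2⟩
  · intro h
    have hor : ∀ p, p ∈ reg Λ ∨ p ∈ regInfty Λ := fun p => by
      rw [← h]; exact em _
    have hcl : ∀ p, p ∈ closure (reg Λ) := fun p =>
      (hor p).elim (fun hp => subset_closure hp) fun hp => frontier_subset_closure hp.1
    rw [continuous_iff_continuousAt]
    intro p
    have key : ∀ U : Set X, IsOpen U → p ∈ U → ∀ L : X → Circle, ContinuousOn L U →
        EqOn L Λ (U ∩ reg Λ) → ContinuousAt (extended Λ) p := by
      intro U hU hpU L hL hLΛ
      refine (hL.continuousAt (hU.mem_nhds hpU)).congr ?_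
      filter_upwards [hU.mem_nhds hpU] with q hq
      exact (extended_eq_of_continuousOn hU hL hLΛ hq (hcl q) (hor q)).symm
    rcases hor p with hp | ⟨-, U, hU, hpU, L, hL, hLΛ⟩
    · exact key _ (isOpen_reg Λ) hp Λ (continuousOn_reg Λ) fun _ _ => rfl
    · exact key U hU hpU L hL hLΛ

theorem continuousOn_circle_iff {V : Set X} : ContinuousOn Λ V ↔ ContinuousOn (fun x => (Λ x : ℂ)) V :=
  (Topology.IsInducing.subtypeVal : IsInducing ((↑) : Circle → ℂ)).continuousOn_iff

end SingularSupportLemmas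

/-! ### The operator `T_Λ` and its adjoint. -/

section BoundaryOperator

theorem conj_circle_mul_self (l : Circle) : (starRingEnd ℂ) (l : ℂ) * l = 1 := by
  rw [← Circle.coe_inv_eq_conj, ← Circle.coe_mul, inv_mul_cancel, Circle.coe_one]

variable {X H : Type*} [TopologicalSpace X] [T2Space X] [LocallyCompactSpace X]
  [NormedAddCommGroup H] [InnerProductSpace ℂ H]

theorem exists_cutoff {V : Set X} (hV : IsOpen V) {p : X} (hp : p ∈ V) {F : X → H × H}
    (hF : ContinuousOn F V) : ∃ (b : X → ℝ) (q : C₀(X, H) × C₀(X, H)), b p = 1 ∧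
      (∀ x ∉ V, b x = 0) ∧ ∀ x, (q.1 x, q.2 x) = (b x : ℂ) • F x := by
  obtain ⟨b, hb1, hb0, hb⟩ := exists_bump (H := H) hV hp
  obtain ⟨f, hf⟩ := hb (fun x => (F x).1) hF.fst
  obtain ⟨g, hg⟩ := hb (fun x => (F x).2) hF.snd
  exact ⟨b, (f, g), hb1, hb0, fun x => Prod.ext (hf x) (hg x)⟩

omit [T2Space X] [LocallyCompactSpace X] in
theorem continuousOn_boundaryVector (φp φm : H) {V : Set X} {l : X → ℂ} (hl : ContinuousOn l V) :
    ContinuousOn (fun x => boundaryVector φp φm (l x)) V :=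
  continuousOn_const.add (hl.smul continuousOn_const)

theorem alphaPlus_smul (φ : H) (c : ℂ) (v : H × H) : alphaPlus φ (c • v) = c * alphaPlus φ v :=
  pairing_smul_right _ _ _

theorem alphaMinus_smul (φ : H) (c : ℂ) (v : H × H) : alphaMinus φ (c • v) = c * alphaMinus φ v :=
  pairing_smul_right _ _ _

theorem boundaryVector_fst_ne_zero [CompleteSpace H] {D : H →ₗ.[ℂ] H} {φp φm : D†.domain}
    (hφm : IsNormalizedDeficiencyVector D (-Complex.I) φm)
    (hφp : IsNormalizedDeficiencyVector D Complex.I φp) (l : ℂ) :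
    (boundaryVector (φp : H) φm l).1 ≠ 0 := by
  intro h
  have h1 : boundaryVector (φp : H) φm l ∈ D†.graph := boundaryVector_mem_graph hφp hφm l
  have h2 := LinearPMap.graph_fst_eq_zero_snd D† h1 h
  have h3 := alphaMinus_boundaryVector hφm φp l
  rw [show boundaryVector (φp : H) φm l = 0 from Prod.ext h h2] at h3
  simp [alphaMinus, pairing] at h3

variable [CompleteSpace H] {D : H →ₗ.[ℂ] H} (hD : IsSymmetricOneOne D) {φp φm : D†.domain}
  (hφp : IsNormalizedDeficiencyVector D Complex.I φp)
  (hφm : IsNormalizedDeficiencyVector D (-Complex.I) φm) {Λ : X → Circle}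

section
include hφp hφm

omit [T2Space X] [LocallyCompactSpace X] in
-- On the open set where `α₋` is nonzero, `Λ` equals the continuous quotient `α₊ / α₋`.
theorem alpha_eq_zero_of_mem_ssupp {q : C₀(X, H) × C₀(X, H)}
    (hq : q ∈ (boundaryOp D φp φm Λ).graph) {x : X} (hx : x ∈ ssupp Λ) :
    alphaPlus (φp : H) (q.1 x, q.2 x) = 0 ∧ alphaMinus (φm : H) (q.1 x, q.2 x) = 0 := by
  rw [mem_boundaryOp_graph hφp hφm] at hq
  have hm : alphaMinus (φm : H) (q.1 x, q.2 x) = 0 := by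
    by_contra h
    have hcp := continuous_alphaPlus (φp : H) (continuous_pair q)
    have hcm := continuous_alphaMinus (φm : H) (continuous_pair q)
    refine hx (mem_reg_of_continuousOn (isOpen_ne_fun hcm continuous_const) ?_ h)
    rw [continuousOn_circle_iff]
    refine (hcp.continuousOn.div hcm.continuousOn fun y hy => hy).congr fun y hy => ?_
    exact (eq_div_of_mul_eq hy (hq y).2.symm)
  exact ⟨by rw [(hq x).2, hm, mul_zero], hm⟩

end

section
include hD hφp hφm

/-- The boundary form against this vector is `i (α₋(v) - conj l α₊(v))`, and `conj l` is the inverse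
of `l`. -/
theorem alphaPlus_eq_of_inner_boundaryVector (l : Circle) {v : H × H} (hv : v ∈ D†.graph)
    (h : inner ℂ (boundaryVector (φp : H) φm l).2 v.1 =
      inner ℂ (boundaryVector (φp : H) φm l).1 v.2) :
    alphaPlus (φp : H) v = l * alphaMinus (φm : H) v := by
  have hform := inner_sub_inner_eq hD hφp hφm (boundaryVector_mem_graph hφp hφm l) hv
  rw [alphaPlus_boundaryVector hφp, alphaMinus_boundaryVector hφm, h, sub_self, map_one] at hform
  have h2 := (mul_eq_zero.1 hform.symm).resolve_left Complex.I_ne_zero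
  linear_combination (-alphaPlus (φp : H) v) * conj_circle_mul_self l - l * h2

omit [T2Space X] [LocallyCompactSpace X] in
theorem mem_boundaryOp_graph_of_mem_graph (Λ : X → Circle) {q : C₀(X, H) × C₀(X, H)}
    (hq : ∀ x, (q.1 x, q.2 x) ∈ D.graph) : q ∈ (boundaryOp D φp φm Λ).graph := by
  rw [mem_boundaryOp_graph hφp hφm]
  intro x
  refine ⟨hD.graph_le (hq x), ?_⟩
  rw [alphaPlus_eq_zero_of_mem_graph hD hφp (hq x), alphaMinus_eq_zero_of_mem_graph hD hφm (hq x),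
    mul_zero]

omit hφp hφm in
theorem dense_domain_of_graph_mem {T : C₀(X, H) →ₗ.[ℂ] C₀(X, H)}
    (h : ∀ q : C₀(X, H) × C₀(X, H), (∀ x, (q.1 x, q.2 x) ∈ D.graph) → q ∈ T.graph) :
    Dense (T.domain : Set C₀(X, H)) := by
  have hd : Dense (Prod.fst '' (D.graph : Set (H × H))) := by
    have h := hD.dense_domain
    rwa [← LinearPMap.graph_map_fst_eq_domain] at h
  refine (dense_setOf_exists_mem D.graph hd).mono ?_
  rintro f ⟨g, hg⟩
  exact LinearPMap.mem_domain_of_mem_graph (h (f, g) hg)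

theorem dense_domain_boundaryOp (Λ : X → Circle) :
    Dense ((boundaryOp D φp φm Λ).domain : Set C₀(X, H)) :=
  dense_domain_of_graph_mem hD fun _ hq => mem_boundaryOp_graph_of_mem_graph hD hφp hφm Λ hq

theorem mem_adjoint_boundaryOp_graph {q : C₀(X, H) × C₀(X, H)} :
    q ∈ (adjoint C₀(X, ℂ) (boundaryOp D φp φm Λ)).graph ↔
      ∀ x, (q.1 x, q.2 x) ∈ D†.graph ∧ (x ∈ reg Λ →
        alphaPlus (φp : H) (q.1 x, q.2 x) = Λ x * alphaMinus (φm : H) (q.1 x, q.2 x)) := by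
  rw [adjoint_graph_eq (dense_domain_boundaryOp hD hφp hφm Λ), mem_adjointGraph_iff]
  constructor
  · intro h x
    -- Test against cutoffs of constant functions with values in the graph of `D`.
    have hmax : (q.1 x, q.2 x) ∈ D†.graph := by
      rw [mem_adjoint_graph_iff hD.dense_domain]
      intro u hu
      obtain ⟨b, r, hb1, -, hr⟩ := exists_cutoff isOpen_univ (mem_univ x) (F := fun _ : X => u)
        continuousOn_const
      have := h r (mem_boundaryOp_graph_of_mem_graph hD hφp hφm Λ fun y => by
        rw [hr]; exact D.graph.smul_mem _ hu) x
      have hrx : (r.1 x, r.2 x) = u := by rw [hr, hb1, Complex.ofReal_one, one_smul]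
      rwa [← hrx]
    refine ⟨hmax, fun hx => ?_⟩
    -- Near a point of `reg Λ` the boundary vector varies continuously, so its cutoff is an
    -- admissible test function.
    obtain ⟨b, r, hb1, hb0, hr⟩ := exists_cutoff (isOpen_reg Λ) hx
      (continuousOn_boundaryVector (φp : H) (φm : H)
        (continuousOn_circle_iff.1 (continuousOn_reg Λ)))
    have hrx : (r.1 x, r.2 x) = boundaryVector (φp : H) φm (Λ x) := by
      rw [hr, hb1, Complex.ofReal_one, one_smul]
    have := h r ((mem_boundaryOp_graph hφp hφm Λ r).2 fun y => by
      rw [hr, alphaPlus_smul, alphaMinus_smul, alphaPlus_boundaryVector hφp,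
        alphaMinus_boundaryVector hφm]
      exact ⟨D†.graph.smul_mem _ (boundaryVector_mem_graph hφp hφm _), by ring⟩) x
    exact alphaPlus_eq_of_inner_boundaryVector hD hφp hφm (Λ x) hmax (by rw [← hrx]; exact this)
  · intro h r hr x
    rw [← sub_eq_zero]
    refine (inner_sub_inner_eq hD hφp hφm (u := (r.1 x, r.2 x)) (v := (q.1 x, q.2 x))
      (((mem_boundaryOp_graph hφp hφm Λ r).1 hr x).1) (h x).1).trans ?_
    -- On `reg Λ` both boundary conditions hold and the form cancels; elsewhere the test function
    -- has zero boundary values.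
    by_cases hx : x ∈ reg Λ
    · rw [(h x).2 hx, ((mem_boundaryOp_graph hφp hφm Λ r).1 hr x).2, map_mul]
      linear_combination -Complex.I * (starRingEnd ℂ) (alphaMinus (φm : H) (r.1 x, r.2 x)) *
        alphaMinus (φm : H) (q.1 x, q.2 x) * conj_circle_mul_self (Λ x)
    · obtain ⟨h1, h2⟩ := alpha_eq_zero_of_mem_ssupp hφp hφm hr hx
      rw [h1, h2]
      simp

theorem mem_adjoint_boundaryOp_graph_of_mem_graph (Λ : X → Circle) {q : C₀(X, H) × C₀(X, H)}
    (hq : ∀ x, (q.1 x, q.2 x) ∈ D.graph) :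
    q ∈ (adjoint C₀(X, ℂ) (boundaryOp D φp φm Λ)).graph := by
  rw [mem_adjoint_boundaryOp_graph hD hφp hφm]
  have := (mem_boundaryOp_graph hφp hφm Λ q).1 (mem_boundaryOp_graph_of_mem_graph hD hφp hφm Λ hq)
  exact fun x => ⟨(this x).1, fun _ => (this x).2⟩

theorem dense_domain_adjoint_boundaryOp (Λ : X → Circle) :
    Dense ((adjoint C₀(X, ℂ) (boundaryOp D φp φm Λ)).domain : Set C₀(X, H)) :=
  dense_domain_of_graph_mem hD fun _ hq =>
    mem_adjoint_boundaryOp_graph_of_mem_graph hD hφp hφm Λ hq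

theorem isSemiregular_boundaryOp (Λ : X → Circle) :
    IsSemiregular C₀(X, ℂ) (boundaryOp D φp φm Λ) where
  smul_mem a f hf := by
    obtain ⟨g, hg⟩ := LinearPMap.mem_domain_iff.1 hf
    rw [mem_boundaryOp_graph hφp hφm] at hg
    refine LinearPMap.mem_domain_of_mem_graph (y := a • g)
      ((mem_boundaryOp_graph hφp hφm Λ _).2 fun x => ?_)
    have : ((a • f) x, (a • g) x) = a x • (f x, g x) := rfl
    simp only [this, alphaPlus_smul, alphaMinus_smul, (hg x).2]
    exact ⟨D†.graph.smul_mem _ (hg x).1, by ring⟩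
  dense_domain := dense_domain_boundaryOp hD hφp hφm Λ
  dense_adjoint_domain := dense_domain_adjoint_boundaryOp hD hφp hφm Λ

omit [T2Space X] [LocallyCompactSpace X] in
theorem isClosed_boundaryOp (Λ : X → Circle) : (boundaryOp D φp φm Λ).IsClosed := by
  have : ((boundaryOp D φp φm Λ).graph : Set (C₀(X, H) × C₀(X, H))) =
      ⋂ x, {q | (q.1 x, q.2 x) ∈ D†.graph} ∩ {q | alphaPlus (φp : H) (q.1 x, q.2 x) =
        Λ x * alphaMinus (φm : H) (q.1 x, q.2 x)} := by
    ext q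
    simp only [SetLike.mem_coe, mem_boundaryOp_graph hφp hφm, mem_iInter]
    rfl
  rw [LinearPMap.IsClosed, this]
  refine isClosed_iInter fun x => ?_
  have hc : Continuous fun q : C₀(X, H) × C₀(X, H) => (q.1 x, q.2 x) :=
    ((continuous_eval_c0 x).comp continuous_fst).prodMk ((continuous_eval_c0 x).comp continuous_snd)
  exact (hD.isClosed_adjoint_graph.preimage hc).inter
    (isClosed_eq (continuous_alphaPlus _ hc) (continuous_const.mul (continuous_alphaMinus _ hc)))

theorem alpha_eq_zero_of_mem_frontier {q : C₀(X, H) × C₀(X, H)}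
    (hq : q ∈ (adjoint C₀(X, ℂ) (boundaryOp D φp φm Λ)).graph) {x : X} (hx : x ∈ frontier (reg Λ))
    (hxi : x ∉ regInfty Λ) :
    alphaPlus (φp : H) (q.1 x, q.2 x) = 0 ∧ alphaMinus (φm : H) (q.1 x, q.2 x) = 0 := by
  rw [mem_adjoint_boundaryOp_graph hD hφp hφm] at hq
  have hcp := continuous_alphaPlus (φp : H) (continuous_pair q)
  have hcm := continuous_alphaMinus (φm : H) (continuous_pair q)
  have hnorm : ‖alphaPlus (φp : H) (q.1 x, q.2 x)‖ = ‖alphaMinus (φm : H) (q.1 x, q.2 x)‖ := by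
    have hEq : EqOn (fun y => ‖alphaPlus (φp : H) (q.1 y, q.2 y)‖)
        (fun y => ‖alphaMinus (φm : H) (q.1 y, q.2 y)‖) (reg Λ) := fun y hy => by
      simp only [(hq y).2 hy, norm_mul, Circle.norm_coe, one_mul]
    exact hEq.closure hcp.norm hcm.norm (frontier_subset_closure hx)
  have hm : alphaMinus (φm : H) (q.1 x, q.2 x) = 0 := by
    by_contra h
    have h' : alphaPlus (φp : H) (q.1 x, q.2 x) ≠ 0 := by
      rwa [← norm_ne_zero_iff, hnorm, norm_ne_zero_iff]
    -- The quotient equals `Λ` on `reg Λ` but need not have modulus one elsewhere, so it is divided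
    -- by its norm to give a circle-valued extension near `x`.
    set F : X → ℂ := fun y => alphaPlus (φp : H) (q.1 y, q.2 y) /
      alphaMinus (φm : H) (q.1 y, q.2 y) with hF
    set V : Set X := {y | alphaPlus (φp : H) (q.1 y, q.2 y) ≠ 0} ∩
      {y | alphaMinus (φm : H) (q.1 y, q.2 y) ≠ 0} with hV
    have hFV : ContinuousOn F V := hcp.continuousOn.div hcm.continuousOn fun y hy => hy.2
    have hF0 : ∀ y ∈ V, F y ≠ 0 := fun y hy => div_ne_zero hy.1 hy.2
    have hval : ∀ y, ∃ c : Circle, y ∈ V → (c : ℂ) = F y / ‖F y‖ := by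
      intro y
      by_cases hy : y ∈ V
      · have : ‖F y / ‖F y‖‖ = 1 := by
          rw [norm_div, Complex.norm_real, norm_norm, div_self (norm_ne_zero_iff.2 (hF0 y hy))]
        exact ⟨⟨_, mem_sphere_zero_iff_norm.2 this⟩, fun _ => rfl⟩
      -- Off `V` the value is irrelevant.
      · exact ⟨1, fun h => absurd h hy⟩
    choose L hL using hval
    refine hxi ⟨hx, V, (isOpen_ne_fun hcp continuous_const).inter
      (isOpen_ne_fun hcm continuous_const), ⟨h', h⟩, L, ?_, ?_⟩
    · rw [continuousOn_circle_iff]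
      refine (hFV.div (Complex.continuous_ofReal.comp_continuousOn hFV.norm) fun y hy => ?_).congr hL
      exact Complex.ofReal_ne_zero.2 (norm_ne_zero_iff.2 (hF0 y hy))
    · rintro y ⟨hy, hyr⟩
      have : F y = Λ y := by
        rw [hF]
        simp only [(hq y).2 hyr]
        exact mul_div_cancel_right₀ _ hy.2
      refine Circle.ext ?_
      rw [hL y hy, this, Circle.norm_coe, Complex.ofReal_one, div_one]
  exact ⟨by rwa [hm, norm_zero, norm_eq_zero] at hnorm, hm⟩

end

end BoundaryOperator

/-! ### Pointwise solution of `(1 + D_l²) ξ = f`. -/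

section Resolvent

variable {H : Type*} [NormedAddCommGroup H] [InnerProductSpace ℂ H] [CompleteSpace H]
  {D : H →ₗ.[ℂ] H} (hD : IsSymmetricOneOne D) {φp φm : D†.domain}
  (hφp : IsNormalizedDeficiencyVector D Complex.I φp)
  (hφm : IsNormalizedDeficiencyVector D (-Complex.I) φm)

/-- Rotating the residual `(f, 0) - F` turns orthogonality into `D_max F.2 = f - F.1`; for `F` in
the graph of an extension of `D` this is the resolvent equation. -/
theorem mem_adjoint_graph_of_orthogonal (hD : Dense (D.domain : Set H)) {f : H} {F : H × H}
    (h : ∀ u ∈ D.graph, pairing u ((f, 0) - F) = 0) : (F.2, f - F.1) ∈ D†.graph := by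
  have := D†.graph.neg_mem ((mem_adjoint_graph_iff_pairing hD _).2 h)
  simpa using this

include hD hφp hφm

theorem pairing_boundaryVector_of_mem_graph (l : ℂ) {u : H × H} (hu : u ∈ D.graph) :
    pairing (boundaryVector (φp : H) φm l) u = 0 := by
  rw [pairing_boundaryVector, alphaPlus_eq_zero_of_mem_graph hD hφp hu,
    alphaMinus_eq_zero_of_mem_graph hD hφm hu]
  ring

/-- If `Qv` is the projection of `(f, 0)` onto the graph of `D`, then adding the component along
the boundary vector gives the projection onto the graph of the extension `D_l` of `D`, whose first
entry is `(1 + D_l²)⁻¹ f`. -/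
theorem projection_boundaryVector (l : Circle) {f : H} {Qv : H × H} (hQ : Qv ∈ D.graph)
    (ho : ∀ u ∈ D.graph, pairing u ((f, 0) - Qv) = 0) {F : H × H}
    (hF : F = Qv + (1 / 2 * pairing (boundaryVector (φp : H) φm l) (f, 0)) •
      boundaryVector (φp : H) φm l) :
    (F ∈ D†.graph ∧ alphaPlus (φp : H) F = l * alphaMinus (φm : H) F) ∧
      (F.2, f - F.1) ∈ D†.graph ∧
        alphaPlus (φp : H) (F.2, f - F.1) = l * alphaMinus (φm : H) (F.2, f - F.1) := by
  set w := boundaryVector (φp : H) φm l with hw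
  set c := 1 / 2 * pairing w (f, 0) with hc
  -- The source of the factor `1 / 2`: `w` is a sum of two orthogonal vectors of norm one, as `|l| =
  -- 1`.
  have hww : pairing w w = 2 := by
    rw [hw, pairing_boundaryVector, alphaMinus_boundaryVector hφm, alphaPlus_boundaryVector hφp,
      conj_circle_mul_self]
    norm_num
  have hwQ : pairing w Qv = 0 := pairing_boundaryVector_of_mem_graph hD hφp hφm l hQ
  have hap : alphaPlus (φp : H) F = l * c := by
    have h1 := alphaPlus_eq_zero_of_mem_graph hD hφp hQ
    rw [alphaPlus] at h1
    rw [hF, alphaPlus, pairing_add_right, h1, ← alphaPlus, alphaPlus_smul, hw,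
      alphaPlus_boundaryVector hφp]
    ring
  have ham : alphaMinus (φm : H) F = c := by
    have h1 := alphaMinus_eq_zero_of_mem_graph hD hφm hQ
    rw [alphaMinus] at h1
    rw [hF, alphaMinus, pairing_add_right, h1, ← alphaMinus, alphaMinus_smul, hw,
      alphaMinus_boundaryVector hφm]
    ring
  have hres : (F.2, f - F.1) ∈ D†.graph := by
    refine mem_adjoint_graph_of_orthogonal hD.dense_domain fun u hu => ?_
    have h1 : pairing u w = 0 := by
      rw [← pairing_conj_symm, pairing_boundaryVector_of_mem_graph hD hφp hφm l hu, map_zero]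
    have h2 := ho u hu
    rw [pairing_sub_right] at h2
    rw [hF, pairing_sub_right, pairing_add_right, pairing_smul_right, h1]
    linear_combination h2
  refine ⟨⟨?_, by rw [hap, ham]⟩, hres,
    alphaPlus_eq_of_inner_boundaryVector hD hφp hφm l hres ?_⟩
  · rw [hF]
    exact D†.graph.add_mem (hD.graph_le hQ)
      (D†.graph.smul_mem _ (boundaryVector_mem_graph hφp hφm _))
  · have h0 : pairing w ((f, 0) - F) = 0 := by
      rw [hF, pairing_sub_right, pairing_add_right, pairing_smul_right, hwQ, hww, hc]
      ring
    simp only [pairing, Prod.fst_sub, Prod.snd_sub, zero_sub, inner_neg_right] at h0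
    rw [← hw]
    linear_combination -h0

end Resolvent

/-! ### The four equivalences. -/

section Regularity

variable {X H : Type*} [TopologicalSpace X] [T2Space X] [LocallyCompactSpace X]
  [NormedAddCommGroup H] [InnerProductSpace ℂ H] [CompleteSpace H]
  {D : H →ₗ.[ℂ] H} (hD : IsSymmetricOneOne D) {φp φm : D†.domain}
  (hφp : IsNormalizedDeficiencyVector D Complex.I φp)
  (hφm : IsNormalizedDeficiencyVector D (-Complex.I) φm) {Λ : X → Circle}

include hD hφp hφm

theorem rangeOneAddAdjointMul_boundaryOp_eq_univ (hcl : IsClosed (reg Λ)) :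
    rangeOneAddAdjointMul C₀(X, ℂ) (boundaryOp D φp φm Λ) = univ := by
  refine eq_univ_of_forall fun f => ?_
  obtain ⟨Q, hQ⟩ := exists_projection D.graph hD.closed
  set w : X → H × H := fun x => boundaryVector (φp : H) φm (Λ x) with hw
  set G : X → H × H := fun x => (1 / 2 * pairing (w x) (f x, 0)) • w x with hG
  -- The graph projection of `(f x, 0)`: onto the graph of the extension `D_l`, `l = Λ x`, over `reg
  -- Λ`, and onto that of `D` over `ssupp Λ`.
  set F : X → H × H := fun x => Q (f x, 0) + (reg Λ).indicator G x with hF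
  have hv : Continuous fun x => (f x, (0 : H)) := (map_continuous f).prodMk continuous_const
  have hv0 : Tendsto (fun x => (f x, (0 : H))) (cocompact X) (𝓝 0) :=
    (zero_at_infty f).prodMk_nhds tendsto_const_nhds
  have hwc : ContinuousOn w (reg Λ) :=
    continuousOn_boundaryVector _ _ (continuousOn_circle_iff.1 (continuousOn_reg Λ))
  have hpair : ContinuousOn (fun x => pairing (w x) (f x, 0)) (reg Λ) :=
    (ContinuousOn.inner (𝕜 := ℂ) hwc.fst hv.continuousOn.fst).add
      (ContinuousOn.inner (𝕜 := ℂ) hwc.snd hv.continuousOn.snd)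
  -- A clopen set has empty frontier, so the two formulas for `F` need no matching.
  have hGc : Continuous ((reg Λ).indicator G) := by
    refine continuous_indicator (fun a ha => ?_) ?_
    · rw [IsClopen.frontier_eq ⟨hcl, isOpen_reg Λ⟩] at ha
      exact ha.elim
    · rw [hcl.closure_eq]
      exact (continuousOn_const.mul hpair).smul hwc
  have hFc : Continuous F := (Q.continuous.comp hv).add hGc
  have hG0 : Tendsto ((reg Λ).indicator G) (cocompact X) (𝓝 0) := by
    -- `Λ` may have no limit at infinity; this bound on `G` does not involve it.
    have hlim : Tendsto (fun x => (‖alphaMinus (φm : H) (f x, 0)‖ +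
        ‖alphaPlus (φp : H) (f x, 0)‖) * (‖((φm : H), -Complex.I • (φm : H))‖ +
          ‖((φp : H), Complex.I • (φp : H))‖)) (cocompact X) (𝓝 0) := by
      have h1 : Tendsto (fun x => alphaMinus (φm : H) (f x, 0)) (cocompact X) (𝓝 0) := by
        have := ((continuous_alphaMinus (φm : H) continuous_id).tendsto (0 : H × H)).comp hv0
        simpa [alphaMinus, pairing, Function.comp_def] using this
      have h2 : Tendsto (fun x => alphaPlus (φp : H) (f x, 0)) (cocompact X) (𝓝 0) := by
        have := ((continuous_alphaPlus (φp : H) continuous_id).tendsto (0 : H × H)).comp hv0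
        simpa [alphaPlus, pairing, Function.comp_def] using this
      simpa using (h1.norm.add h2.norm).mul_const _
    refine squeeze_zero_norm (fun x => ?_) hlim
    refine (norm_indicator_le_norm_self _ _).trans ?_
    rw [hG, norm_smul]
    refine mul_le_mul ?_ ?_ (norm_nonneg _) (by positivity)
    · rw [hw, pairing_boundaryVector, norm_mul]
      have h1 := norm_add_le (alphaMinus (φm : H) (f x, 0))
        ((starRingEnd ℂ) (Λ x : ℂ) * alphaPlus (φp : H) (f x, 0))
      rw [norm_mul, RCLike.norm_conj, Circle.norm_coe, one_mul] at h1
      have h2 : ‖(1 / 2 : ℂ)‖ ≤ 1 := by norm_num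
      calc _ ≤ 1 * _ := mul_le_mul_of_nonneg_right h2 (norm_nonneg _)
        _ ≤ _ := by rwa [one_mul]
    · refine (norm_add_le _ _).trans ?_
      rw [norm_smul, Circle.norm_coe, one_mul]
  have hF0 : Tendsto F (cocompact X) (𝓝 0) := by
    have h1 : Tendsto (fun x => Q (f x, 0)) (cocompact X) (𝓝 0) := by
      simpa [Function.comp_def] using (Q.continuous.tendsto (0 : H × H)).comp hv0
    simpa using h1.add hG0
  let u : C₀(X, H) := ⟨⟨fun x => (F x).1, hFc.fst⟩, (continuous_fst.tendsto (0 : H × H)).comp hF0⟩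
  let g : C₀(X, H) := ⟨⟨fun x => (F x).2, hFc.snd⟩, (continuous_snd.tendsto (0 : H × H)).comp hF0⟩
  have hreg : ∀ x ∈ reg Λ, _ := fun x hx =>
    projection_boundaryVector hD hφp hφm (Λ x) (hQ (f x, 0)).1 (hQ (f x, 0)).2 (F := F x)
      (by rw [hF]; simp only [indicator_of_mem hx]; rfl)
  have hssupp : ∀ x ∉ reg Λ, F x = Q (f x, 0) := fun x hx => by
    rw [hF]; simp only [indicator_of_notMem hx, add_zero]
  refine (mem_rangeOneAddAdjointMul_iff _ _).2 ⟨u, g, f - u,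
    (mem_boundaryOp_graph hφp hφm Λ _).2 fun x => ?_,
    (mem_adjoint_boundaryOp_graph hD hφp hφm).2 fun x => ?_, (add_sub_cancel u f).symm⟩
  · change F x ∈ _ ∧ alphaPlus _ (F x) = _ * alphaMinus _ (F x)
    by_cases hx : x ∈ reg Λ
    · exact (hreg x hx).1
    · have hmem : F x ∈ D.graph := hssupp x hx ▸ (hQ (f x, 0)).1
      refine ⟨hD.graph_le hmem, ?_⟩
      rw [alphaPlus_eq_zero_of_mem_graph hD hφp hmem, alphaMinus_eq_zero_of_mem_graph hD hφm hmem,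
        mul_zero]
  · change ((F x).2, f x - (F x).1) ∈ _ ∧ (_ → alphaPlus _ ((F x).2, f x - (F x).1) =
      _ * alphaMinus _ ((F x).2, f x - (F x).1))
    by_cases hx : x ∈ reg Λ
    · exact ⟨(hreg x hx).2.1, fun _ => (hreg x hx).2.2⟩
    · refine ⟨mem_adjoint_graph_of_orthogonal hD.dense_domain ?_, fun h => absurd h hx⟩
      rw [hssupp x hx]
      exact (hQ (f x, 0)).2

theorem isRegular_boundaryOp_iff :
    IsRegular C₀(X, ℂ) (boundaryOp D φp φm Λ) ↔ interior (ssupp Λ) = ssupp Λ := by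
  rw [interior_eq_iff_isOpen]
  constructor
  · intro hreg
    rw [← interior_eq_iff_isOpen]
    refine Subset.antisymm interior_subset fun p hp => ?_
    by_contra hpi
    have hfr := mem_frontier_reg_of_notMem_interior hp hpi
    have : (𝓝[reg Λ] p).NeBot :=
      mem_closure_iff_nhdsWithin_neBot.1 (frontier_subset_closure hfr)
    -- `Λ` need not converge at `p`, but by compactness of the circle it does along an ultrafilter
    -- on `reg Λ`. The adjoint condition then survives at `p` with the limit `l`.
    let 𝒰 : Ultrafilter X := Ultrafilter.of (𝓝[reg Λ] p)
    have h𝒰 : (𝒰 : Filter X) ≤ 𝓝[reg Λ] p := Ultrafilter.of_le _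
    obtain ⟨l, -, hl⟩ := isCompact_univ.ultrafilter_le_nhds (𝒰.map Λ) (by simp)
    have hlim : Tendsto (fun x => (Λ x : ℂ)) 𝒰 (𝓝 l) :=
      (continuous_subtype_val.tendsto l).comp (show Tendsto Λ 𝒰 (𝓝 l) from hl)
    refine not_dense_of_inner_eq_zero p (boundaryVector_fst_ne_zero hφm hφp l) ?_ hreg.dense_range
    intro y hy
    obtain ⟨u, g, h, hug, hgh, rfl⟩ := (mem_rangeOneAddAdjointMul_iff _ _).1 hy
    obtain ⟨hup, hum⟩ := alpha_eq_zero_of_mem_ssupp hφp hφm hug hp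
    rw [mem_adjoint_boundaryOp_graph hD hφp hφm] at hgh
    have hlimgh : alphaPlus (φp : H) (g p, h p) = l * alphaMinus (φm : H) (g p, h p) := by
      have hle : (𝒰 : Filter X) ≤ 𝓝 p := h𝒰.trans nhdsWithin_le_nhds
      have hcp := continuous_alphaPlus (φp : H) (continuous_pair (g, h))
      have hcm := continuous_alphaMinus (φm : H) (continuous_pair (g, h))
      refine tendsto_nhds_unique ((hcp.tendsto p).mono_left hle)
        ((hlim.mul ((hcm.tendsto p).mono_left hle)).congr' ?_)
      filter_upwards [h𝒰 self_mem_nhdsWithin] with x hx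
      exact ((hgh x).2 hx).symm
    -- With `w` the boundary vector of `l`: `(g, h)` satisfies the same condition, so `⟨w.2, g⟩ =
    -- ⟨w.1, h⟩` at `p`. Zero boundary values of `(u, g)` give `⟨w.1, u⟩ + ⟨w.2, g⟩ = 0`, so `w.1`
    -- is orthogonal to `u + h`.
    have hform := inner_sub_inner_eq hD hφp hφm (boundaryVector_mem_graph hφp hφm (l : ℂ)) (hgh p).1
    rw [alphaPlus_boundaryVector hφp, alphaMinus_boundaryVector hφm, hlimgh, map_one] at hform
    have hpair := pairing_boundaryVector (φp : H) (φm : H) (l : ℂ) (u p, g p)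
    rw [hup, hum, mul_zero, add_zero, pairing] at hpair
    rw [ZeroAtInftyContinuousMap.add_apply, inner_add_right]
    linear_combination hpair - hform + Complex.I * alphaMinus (φm : H) (g p, h p) *
      conj_circle_mul_self l
  · intro h
    have hcl : IsClosed (reg Λ) := by
      rw [← compl_compl (reg Λ)]; exact h.isClosed_compl
    refine ⟨isSemiregular_boundaryOp hD hφp hφm Λ, isClosed_boundaryOp hD hφp hφm Λ, ?_⟩
    rw [rangeOneAddAdjointMul_boundaryOp_eq_univ hD hφp hφm hcl]
    exact dense_univ

theorem isSelfadjoint_boundaryOp_iff :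
    IsSelfadjoint C₀(X, ℂ) (boundaryOp D φp φm Λ) ↔ ssupp Λ = ssuppR Λ := by
  constructor
  · intro hsa
    -- A cutoff of the boundary vector of `L` lies in the adjoint graph and has `α₋ = 1` at `p`,
    -- which is impossible for `T_Λ` at a singular point.
    have hsub : ∀ V : Set X, IsOpen V → ∀ L : X → Circle, ContinuousOn L V →
        (∀ x ∈ V ∩ reg Λ, L x = Λ x) → V ⊆ reg Λ := by
      intro V hV L hL hLΛ p hp
      obtain ⟨b, q, hb1, hb0, hq⟩ := exists_cutoff hV hp
        (continuousOn_boundaryVector (φp : H) (φm : H) (continuousOn_circle_iff.1 hL))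
      have hmem : q ∈ (adjoint C₀(X, ℂ) (boundaryOp D φp φm Λ)).graph := by
        refine (mem_adjoint_boundaryOp_graph hD hφp hφm).2 fun x => ?_
        rw [hq, alphaPlus_smul, alphaMinus_smul, alphaPlus_boundaryVector hφp,
          alphaMinus_boundaryVector hφm]
        refine ⟨D†.graph.smul_mem _ (boundaryVector_mem_graph hφp hφm _), fun hx => ?_⟩
        by_cases hxV : x ∈ V
        · rw [hLΛ x ⟨hxV, hx⟩]; ring
        · rw [hb0 x hxV]; simp
      rw [hsa.adjoint_eq] at hmem
      by_contra hpr
      have := (alpha_eq_zero_of_mem_ssupp hφp hφm hmem hpr).2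
      rw [hq, alphaMinus_smul, alphaMinus_boundaryVector hφm, hb1] at this
      simp at this
    refine Subset.antisymm (fun p hp => ⟨?_, ?_⟩) fun p hp => (isClosed_ssupp Λ).frontier_subset hp.1
    · rw [frontier_ssupp]
      refine mem_frontier_reg_of_notMem_interior hp fun hpi => hp ?_
      -- The interior of `ssupp Λ` misses `reg Λ`, so any continuous `L` will do.
      exact hsub _ isOpen_interior (fun _ => 1) continuousOn_const
        (fun x hx => absurd hx.2 (interior_subset hx.1)) hpi
    · rintro ⟨-, U, hU, hpU, L, hL, hLΛ⟩
      exact hp (hsub U hU L hL hLΛ hpU)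
  · intro h
    refine ⟨isSemiregular_boundaryOp hD hφp hφm Λ, LinearPMap.eq_of_eq_graph ?_⟩
    ext q
    rw [mem_boundaryOp_graph hφp hφm]
    constructor
    · intro hq x
      have hx := (mem_adjoint_boundaryOp_graph hD hφp hφm).1 hq x
      refine ⟨hx.1, ?_⟩
      by_cases hr : x ∈ reg Λ
      · exact hx.2 hr
      · have hxs : x ∈ ssuppR Λ := h ▸ (hr : x ∈ ssupp Λ)
        obtain ⟨h1, h2⟩ := alpha_eq_zero_of_mem_frontier hD hφp hφm hq
          (frontier_ssupp Λ ▸ hxs.1) hxs.2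
        rw [h1, h2, mul_zero]
    · intro hq
      exact (mem_adjoint_boundaryOp_graph hD hφp hφm).2 fun x => ⟨(hq x).1, fun _ => (hq x).2⟩

theorem isSelfadjoint_and_isRegular_boundaryOp_iff :
    IsSelfadjoint C₀(X, ℂ) (boundaryOp D φp φm Λ) ∧ IsRegular C₀(X, ℂ) (boundaryOp D φp φm Λ) ↔
      Continuous Λ := by
  rw [isSelfadjoint_boundaryOp_iff hD hφp hφm, isRegular_boundaryOp_iff hD hφp hφm,
    continuous_iff_ssupp_eq_empty]
  constructor
  · rintro ⟨h1, h2⟩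
    refine eq_empty_of_forall_notMem fun p hp => ?_
    have hp' : p ∈ ssuppR Λ := h1 ▸ hp
    -- A point cannot be both in the frontier and in the interior of `ssupp Λ`.
    exact hp'.1.2 (h2.symm ▸ hp)
  · intro h
    simp [ssuppR, h]

/-- Here `reg Λ` is dense, so the adjoint's boundary condition there propagates to all of `X` by
continuity. -/
theorem adjoint_boundaryOp_eq_boundaryOp_extended (h : Continuous (extended Λ)) :
    adjoint C₀(X, ℂ) (boundaryOp D φp φm Λ) = boundaryOp D φp φm (extended Λ) := by
  have hdense : Dense (reg Λ) := by
    intro p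
    by_cases hp : p ∈ reg Λ
    · exact subset_closure hp
    · have : p ∈ regInfty Λ := continuous_extended_iff.1 h ▸ (hp : p ∈ ssupp Λ)
      exact frontier_subset_closure this.1
  refine LinearPMap.eq_of_eq_graph ?_
  ext q
  rw [mem_boundaryOp_graph hφp hφm, mem_adjoint_boundaryOp_graph hD hφp hφm]
  constructor
  · intro hq x
    refine ⟨(hq x).1, ?_⟩
    have hcp := continuous_alphaPlus (φp : H) (continuous_pair q)
    have hcm := continuous_alphaMinus (φm : H) (continuous_pair q)
    refine congrFun (hcp.ext_on hdense ((continuous_subtype_val.comp h).mul hcm) fun y hy => ?_) x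
    change _ = (extended Λ y : ℂ) * _
    rw [extended_eq_of_mem_reg hy]
    exact (hq y).2 hy
  · intro hq x
    exact ⟨(hq x).1, fun hx => extended_eq_of_mem_reg hx ▸ (hq x).2⟩

theorem isSelfadjoint_and_isRegular_adjoint_boundaryOp_iff :
    IsSelfadjoint C₀(X, ℂ) (adjoint C₀(X, ℂ) (boundaryOp D φp φm Λ)) ∧
      IsRegular C₀(X, ℂ) (adjoint C₀(X, ℂ) (boundaryOp D φp φm Λ)) ↔
        Continuous (extended Λ) := by
  constructor
  · rintro ⟨hsa, hreg⟩
    rw [continuous_extended_iff]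
    refine Subset.antisymm (fun p hp => ?_) (regInfty_subset_ssupp Λ)
    by_cases hpi : p ∈ interior (ssupp Λ)
    · exfalso
      -- The adjoint imposes no boundary condition here, so a cutoff of `φ₋` is in its domain;
      -- symmetry would force `i ‖φ₋‖² = -i ‖φ₋‖²`.
      obtain ⟨b, q, hb1, hb0, hq⟩ := exists_cutoff isOpen_interior hpi
        (F := fun _ : X => ((φm : H), -Complex.I • (φm : H))) continuousOn_const
      have hmem : q ∈ (adjoint C₀(X, ℂ) (boundaryOp D φp φm Λ)).graph := by
        refine (mem_adjoint_boundaryOp_graph hD hφp hφm).2 fun x => ?_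
        rw [hq]
        refine ⟨D†.graph.smul_mem _ hφm.mem_graph, fun hx => ?_⟩
        rw [hb0 x fun h => interior_subset h hx, alphaPlus_smul, alphaMinus_smul]
        simp
      have hmem' := hmem
      rw [← hsa.adjoint_eq, adjoint_graph_eq (dense_domain_adjoint_boundaryOp hD hφp hφm Λ),
        mem_adjointGraph_iff] at hmem'
      have := hmem' q hmem p
      have hqp : (q.1 p, q.2 p) = ((φm : H), -Complex.I • (φm : H)) := by
        rw [hq, hb1, Complex.ofReal_one, one_smul]
      obtain ⟨h1, h2⟩ := Prod.mk.inj hqp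
      rw [h1, h2, inner_smul_left, inner_smul_right, map_neg, Complex.conj_I] at this
      have h3 : inner ℂ (φm : H) (φm : H) ≠ 0 := inner_self_ne_zero.2 hφm.coe_ne_zero
      have h4 : (2 * Complex.I) * inner ℂ (φm : H) (φm : H) = 0 := by linear_combination this
      exact mul_ne_zero (by simp) h3 h4
    · by_contra hpinf
      have hfr := mem_frontier_reg_of_notMem_interior hp hpi
      refine not_dense_of_inner_eq_zero p hφm.coe_ne_zero ?_ hreg.dense_range
      intro y hy
      obtain ⟨u, g, h, hug, hgh, rfl⟩ := (mem_rangeOneAddAdjointMul_iff _ _).1 hy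
      rw [hsa.adjoint_eq] at hgh
      -- By selfadjointness `(u, g)` and `(g, h)` are both in the graph of `T_Λ⋆`, so `α₋` vanishes
      -- on both at `p`: `⟨φ₋, u⟩ = -i ⟨φ₋, g⟩` and `⟨φ₋, g⟩ = -i ⟨φ₋, h⟩`. Thus `φ₋` is orthogonal
      -- to `u + h`.
      have h1 := (alpha_eq_zero_of_mem_frontier hD hφp hφm hug hfr hpinf).2
      have h2 := (alpha_eq_zero_of_mem_frontier hD hφp hφm hgh hfr hpinf).2
      simp only [alphaMinus, pairing, inner_smul_left, map_neg, Complex.conj_I] at h1 h2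
      rw [ZeroAtInftyContinuousMap.add_apply, inner_add_right]
      linear_combination h1 - Complex.I * h2 + inner ℂ (φm : H) (h p) * Complex.I_mul_I
  · intro h
    rw [adjoint_boundaryOp_eq_boundaryOp_extended hD hφp hφm h]
    exact (isSelfadjoint_and_isRegular_boundaryOp_iff hD hφp hφm).2 h

end Regularity

end HilbertModule

theorem proposition6
    {H : Type*} [NormedAddCommGroup H] [InnerProductSpace ℂ H] [CompleteSpace H]
    [TopologicalSpace.SeparableSpace H]
    {X : Type*} [TopologicalSpace X] [T2Space X] [LocallyCompactSpace X]
    [MeasurableSpace X] [BorelSpace X]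
    (D : H →ₗ.[ℂ] H) (hD : HilbertModule.IsSymmetricOneOne D)
    (φp φm : D†.domain)
    (hφp : HilbertModule.IsNormalizedDeficiencyVector D Complex.I φp)
    (hφm : HilbertModule.IsNormalizedDeficiencyVector D (-Complex.I) φm)
    (Λ : X → Circle) (hΛ : Measurable fun x => (Λ x : ℂ)) :
    (HilbertModule.IsRegular C₀(X, ℂ) (HilbertModule.boundaryOp D φp φm Λ) ↔
      interior (HilbertModule.ssupp Λ) = HilbertModule.ssupp Λ) ∧
    (HilbertModule.IsSelfadjoint C₀(X, ℂ) (HilbertModule.boundaryOp D φp φm Λ) ↔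
      HilbertModule.ssupp Λ = HilbertModule.ssuppR Λ) ∧
    ((HilbertModule.IsSelfadjoint C₀(X, ℂ) (HilbertModule.boundaryOp D φp φm Λ) ∧
        HilbertModule.IsRegular C₀(X, ℂ) (HilbertModule.boundaryOp D φp φm Λ) ↔ Continuous Λ) ∧
      (Continuous Λ ↔ HilbertModule.ssupp Λ = ∅)) ∧
    ((HilbertModule.IsSelfadjoint C₀(X, ℂ)
          (HilbertModule.adjoint C₀(X, ℂ) (HilbertModule.boundaryOp D φp φm Λ)) ∧
        HilbertModule.IsRegular C₀(X, ℂ)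
          (HilbertModule.adjoint C₀(X, ℂ) (HilbertModule.boundaryOp D φp φm Λ)) ↔
        Continuous (HilbertModule.extended Λ)) ∧
      (Continuous (HilbertModule.extended Λ) ↔
        HilbertModule.ssupp Λ = HilbertModule.regInfty Λ)) := by
  exact ⟨HilbertModule.isRegular_boundaryOp_iff hD hφp hφm,
    HilbertModule.isSelfadjoint_boundaryOp_iff hD hφp hφm,
    ⟨HilbertModule.isSelfadjoint_and_isRegular_boundaryOp_iff hD hφp hφm,
      HilbertModule.continuous_iff_ssupp_eq_empty⟩,
    ⟨HilbertModule.isSelfadjoint_and_isRegular_adjoint_boundaryOp_iff hD hφp hφm,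
      HilbertModule.continuous_extended_iff⟩⟩
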